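/- **Setting.** Signals are real-valued functions on $[0,\infty)$, identified when equal almost everywhere; $P_T$ denotes truncation to $[0,T]$, $\|\cdot\|_T$ the norm of $L_2[0,T]$, $\|\cdot\|_\infty$ the essential supremum on $[0,\infty)$, and $L_{2e}$ the set of signals that are in $L_2[0,T]$ for every $T$. Consider the Lur'e system $y=Ge$, $e=u-\phi(y)$, where $G$ is a causal real linear time-invariant system on $L_{2e}$ with zero initial conditions and transfer function $G(s)$, and $\phi:\mathbb R\to\mathbb R$ acts pointwise in time. Assume that there are functions $a,b,c,d$ such that for all $A>0$ and $|x|,|y|\le A$ $$a(A)\le\frac{\phi(x)-\phi(y)}{x-y}\le b(A)\ (x\ne y),\qquad c(A)\le\frac{\phi(x)}{x}\le d(A)\ (x\neq 0).$$ *Condition 1:* $G(s)$ is proper (bounded for $|s|\to\infty$ in $\mathrm{Re}\,s\ge0$) and stable (analytic at every point of $\mathrm{Re}\, s\ge 0$, i.e. no poles there); $\gamma(\phi)=\sup_{y\in L_2}\|\phi(y)\|/\|y\|<\infty$; and for each $\tau\in[0,1]$ the system $[G,\tau\phi]$ is well-posed, i.e. the map $e\mapsto u=e+\tau\phi(Ge)$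 has a causal inverse on $L_{2e}$. A signal $u$ is called *$T$-periodic* if $u(t+T/2)=-u(t)$ for all $t\ge0$. The system is *period-preserving* if for every $T>0$ and every $T$-periodic $u\in L_{2e}$ the signals $e,y$ converge asymptotically to $T$-periodic $\tilde e,\tilde y\in L_{2e}$, i.e. for every $\epsilon>0$ there is $t>0$ with $|y(\tau)-\tilde y(\tau)|<\epsilon$ for all $\tau\ge t$, and likewise for $e$. For $T>0$, $\omega=2\pi/T$, let $\mathcal U_\omega$ be the set of $u\in L_2[0,T]$ whose Fourier series $\sum_k\hat u_ke^{jk\omega t}$ contains odd $k$ only; its elements are extended $T$-periodically to $[0,\infty)$. Let $\mathrm{SRG}_{\mathcal U_\omega}(G)\subseteq\mathbb C$ be the scaled graph of the map $G:\mathcal U_\omega\to\mathcal U_\omega$, $u\mapsto\tilde v=\sum_{k\text{ odd}}G(jk\omega)\hat u_ke^{jk\omega t}$, that is, the set of all $\frac{\|\tilde v\|_T}{\|u\|_T}e^{\pm j\angle(u,\tilde v)}$ with $0\ne u\in\mathcal U_\omega$, where $\angle(u,\tilde v)=\cos^{-1}\frac{\langle u,\tilde v\rangle}{\|u\|_T\|\tilde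 v\|_T}$. The inverse of a set is taken elementwise in $\mathbb C\cup\{\infty\}$ with $0^{-1}=\infty$; $D_{[\alpha,\beta]}$ is the closed disk centred on $\mathbb R$ that meets $\mathbb R$ in $[\alpha,\beta]$; and $\mathrm{dist}(\mathcal C_1,\mathcal C_2)=\inf_{z_i\in\mathcal C_i}|z_1-z_2|\in[0,\infty]$, with $|\infty-z|=\infty$ for finite $z$ and $|\infty-\infty|=0$. We put $1/\infty=0$. Let $\lambda_{\omega,A}$ be the least $\lambda\in[0,\infty]$ such that $\|\tilde y\|_T\le\lambda\|u\|_T$ for all $u\in\mathcal U_\omega$ whose steady state satisfies $\|\tilde y\|_\infty\le A$, and $\lambda^\partial_{\omega,A}$ the least $\lambda\in[0,\infty]$ such that $\tilde y\in H^1[0,T]$ and $\|\tilde y'\|_T\le\lambda\|u'\|_T$ for all $u\in\mathcal U_\omega\cap H^1[0,T]$ whose steady state satisfies $\|\tilde y\|_\infty\le A$ (primes are weak derivatives; an infimum over an empty set is $\infty$). **Lemma.** Suppose that Condition 1 holds and that the system is period-preserving. Let $T>0$, $\omega=2\pi/T$ and $A>0$. 1. If $\mathrm{dist}(\mathrm{SRG}_{\mathcal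 U_\omega}(G)^{-1},-D_{[c(A),d(A)]})=r_{\omega,A}>0$, then $\|\tilde y\|_T\le\frac1{r_{\omega,A}}\|u\|_T$ for every $u\in\mathcal U_\omega$ for which $\|y\|_\infty\le A$; moreover $\lambda_{\omega,A}\le\frac1{r_{\omega,A}}$. 2. If $\mathrm{dist}(\mathrm{SRG}_{\mathcal U_\omega}(G)^{-1},-D_{[a(A),b(A)]})=r^\partial_{\omega,A}>0$, then $\tilde y\in H^1[0,T]$ and $\|\tilde y'\|_T\le\frac1{r^\partial_{\omega,A}}\|u'\|_T$ for every $u\in\mathcal U_\omega\cap H^1[0,T]$ for which $\|y\|_\infty\le A$; moreover $\lambda^\partial_{\omega,A}\le\frac1{r^\partial_{\omega,A}}$. -/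

import Mathlib

open MeasureTheory Filter
open scoped ENNReal Pointwise

namespace Lure

noncomputable section

/- Signals are functions `ℝ → ℝ` of which only the values at (almost all) times `t ≥ 0` matter. -/

/-- Lebesgue measure on the time axis `[0, ∞)`. -/
def timeAxis : Measure ℝ := volume.restrict (Set.Ici 0)

/-- Lebesgue measure on `[0, T]`. -/
def horizon (T : ℝ) : Measure ℝ := volume.restrict (Set.Icc 0 T)

/-- The norm `‖u‖_T` of `L₂[0, T]`. -/
def normT (T : ℝ) (u : ℝ → ℝ) : ℝ≥0∞ := eLpNorm u 2 (horizon T)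

/-- The norm `‖u‖_∞` on `[0, ∞)`. -/
def normSup (u : ℝ → ℝ) : ℝ≥0∞ := eLpNorm u ⊤ timeAxis

/-- The space `L₂` of finite-energy signals on `[0, ∞)`. -/
def IsL2 (u : ℝ → ℝ) : Prop := MemLp u 2 timeAxis

/-- The extended space `L₂ₑ`: finite energy on every `[0, T]`. -/
def IsL2e (u : ℝ → ℝ) : Prop := ∀ T : ℝ, 0 ≤ T → MemLp u 2 (horizon T)

/-- The truncation operator `P_T`. -/
def truncate (T : ℝ) (u : ℝ → ℝ) : ℝ → ℝ := (Set.Iic T).indicator u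

/-- The `L₂`-gain `γ(R) = sup_{u ∈ L₂} ‖R u‖ / ‖u‖` (the input `u = 0` contributes `0` when
`R 0 = 0`). -/
def gain (R : (ℝ → ℝ) → (ℝ → ℝ)) : ℝ≥0∞ :=
  ⨆ (u : ℝ → ℝ) (_ : IsL2 u), eLpNorm (R u) 2 timeAxis / eLpNorm u 2 timeAxis

/-- `v` is a weak derivative of `u` on `[0, T]`. -/
def HasWeakDeriv (T : ℝ) (u v : ℝ → ℝ) : Prop :=
  ∀ ψ : ℝ → ℝ, ContDiff ℝ 1 ψ → HasCompactSupport ψ → tsupport ψ ⊆ Set.Ioo 0 T →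
    ∫ t, u t * deriv ψ t ∂(horizon T) = -∫ t, v t * ψ t ∂(horizon T)

/-- `u ∈ H¹[0, T]`, with weak derivative `u'`. -/
def IsH1WithDeriv (T : ℝ) (u u' : ℝ → ℝ) : Prop :=
  MemLp u 2 (horizon T) ∧ MemLp u' 2 (horizon T) ∧ HasWeakDeriv T u u'

/-! ### Periodic signals -/

/-- The set `𝒰_ω ⊆ L₂[0, T]`, `ω = 2π / T`, of real signals whose Fourier series contains odd
harmonics only. -/
def oddHarmonics {T : ℝ} (hT : 0 < T) : Set (Lp ℝ 2 (horizon T)) :=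
  {f | ∀ k : ℤ, Even k → fourierCoeffOn hT (fun t => ((f t : ℝ) : ℂ)) k = 0}

/-- The signal `u` on `[0, ∞)` is the periodic repetition of an element of `𝒰_ω`. -/
def IsOddHarmonicSignal {T : ℝ} (hT : 0 < T) (u : ℝ → ℝ) : Prop :=
  (∃ f ∈ oddHarmonics hT, u =ᵐ[horizon T] f) ∧ ∀ᵐ t ∂timeAxis, u (t + T) = u t

/-- `T`-periodicity in the sense of odd half-wave symmetry: `u (t + T/2) = - u t`. -/
def IsHalfWavePeriodic (T : ℝ) (u : ℝ → ℝ) : Prop :=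
  ∀ᵐ t ∂timeAxis, u (t + T / 2) = - u t

/-- `y` converges asymptotically to `y'`. -/
def ConvergesTo (y y' : ℝ → ℝ) : Prop :=
  ∀ ε : ℝ, 0 < ε → ∃ t : ℝ, 0 < t ∧ ∀ᵐ τ ∂timeAxis, t ≤ τ → |y τ - y' τ| < ε

/-- `y'` is the `T`-periodic steady state of `y`. -/
def IsSteadyState (T : ℝ) (y y' : ℝ → ℝ) : Prop :=
  IsL2e y' ∧ IsHalfWavePeriodic T y' ∧ ConvergesTo y y'

/-! ### Linear time-invariant systems -/

/-- The (one-sided) Laplace transform. -/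
def laplace (u : ℝ → ℝ) (s : ℂ) : ℂ := ∫ t, Complex.exp (-s * t) * (u t : ℂ) ∂timeAxis

/-- `G` is the transfer function of a proper and stable real LTI system: it is bounded near
infinity in the closed right half-plane and has no poles there. -/
structure IsProperStable (G : ℂ → ℂ) : Prop where
  /-- real inputs give real outputs -/
  real : ∀ s : ℂ, 0 ≤ s.re → G (starRingEnd ℂ s) = starRingEnd ℂ (G s)
  proper : ∃ ρ M : ℝ, ∀ s : ℂ, 0 ≤ s.re → ρ ≤ ‖s‖ → ‖G s‖ ≤ M
  stable : ∀ s : ℂ, 0 ≤ s.re → AnalyticAt ℂ G s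

/-- `y = G e` on `L₂ₑ`, for the causal LTI system (with zero initial condition) that has transfer
function `G`. On `L₂` the system multiplies Laplace transforms by `G`; by causality, on `[0, T]`
the output for `e ∈ L₂ₑ` is the output for `P_T e ∈ L₂`. -/
def IsOutput (G : ℂ → ℂ) (e y : ℝ → ℝ) : Prop :=
  IsL2e e ∧ IsL2e y ∧ ∀ T : ℝ, 0 ≤ T → ∃ z : ℝ → ℝ, IsL2 z ∧
    (∀ s : ℂ, 0 < s.re → laplace z s = G s * laplace (truncate T e) s) ∧ y =ᵐ[horizon T] z

/-- The graph of the steady-state map `G : 𝒰_ω → 𝒰_ω`,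
`∑ û_k e^{jkωt} ↦ ∑ G(jkω) û_k e^{jkωt}`, where `ω = 2π / T`. -/
def steadyStateMap {T : ℝ} (hT : 0 < T) (G : ℂ → ℂ) :
    Set (Lp ℝ 2 (horizon T) × Lp ℝ 2 (horizon T)) :=
  {p | p.1 ∈ oddHarmonics hT ∧ p.2 ∈ oddHarmonics hT ∧
    ∀ k : ℤ, fourierCoeffOn hT (fun t => ((p.2 t : ℝ) : ℂ)) k =
      G (Complex.I * k * ((2 * Real.pi / T : ℝ) : ℂ)) *
        fourierCoeffOn hT (fun t => ((p.1 t : ℝ) : ℂ)) k}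

/-! ### The Lur'e system -/

/-- `e, y` are the internal signals of the Lur'e system `y = G e`, `e = u - φ(y)`. -/
def IsLoop (G : ℂ → ℂ) (φ : ℝ → ℝ) (u e y : ℝ → ℝ) : Prop :=
  IsOutput G e y ∧ ∀ᵐ t ∂timeAxis, e t = u t - φ (y t)

/-- Well-posedness of `[G, φ]`: the map `e ↦ u = e + φ(G e)` has a causal inverse on `L₂ₑ`. -/
def WellPosed (G : ℂ → ℂ) (φ : ℝ → ℝ) : Prop :=
  (∀ u, IsL2e u → ∃ e y, IsLoop G φ u e y) ∧
  ∀ T : ℝ, 0 ≤ T → ∀ u₁ u₂ e₁ e₂ y₁ y₂ : ℝ → ℝ, IsL2e u₁ → IsL2e u₂ →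
    IsLoop G φ u₁ e₁ y₁ → IsLoop G φ u₂ e₂ y₂ → u₁ =ᵐ[horizon T] u₂ → e₁ =ᵐ[horizon T] e₂

/-- The standing condition on the Lur'e system: `G` is proper and stable, `γ(φ) < ∞`, and
`[G, τφ]` is well-posed for all `τ ∈ [0, 1]`. -/
structure Condition (G : ℂ → ℂ) (φ : ℝ → ℝ) : Prop where
  properStable : IsProperStable G
  gain_lt_top : gain (fun y t => φ (y t)) < ⊤
  wellPosed : ∀ τ ∈ Set.Icc (0 : ℝ) 1, WellPosed G (fun x => τ * φ x)

/-- The Lur'e system is period-preserving. -/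
def PeriodPreserving (G : ℂ → ℂ) (φ : ℝ → ℝ) : Prop :=
  ∀ T : ℝ, 0 < T → ∀ u : ℝ → ℝ, IsL2e u → IsHalfWavePeriodic T u →
    ∀ e y : ℝ → ℝ, IsLoop G φ u e y → ∃ e' y', IsSteadyState T e e' ∧ IsSteadyState T y y'

/-- The amplitude-dependent slope bounds `[a(A), b(A)]` and sector bounds `[c(A), d(A)]` of the
static nonlinearity `φ`. -/
structure HasSlopeSectorBounds (φ a b c d : ℝ → ℝ) : Prop where
  slope : ∀ A : ℝ, 0 < A → ∀ x y : ℝ, |x| ≤ A → |y| ≤ A → x ≠ y →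
    a A ≤ (φ x - φ y) / (x - y) ∧ (φ x - φ y) / (x - y) ≤ b A
  sector : ∀ A : ℝ, 0 < A → ∀ x : ℝ, |x| ≤ A → x ≠ 0 → c A ≤ φ x / x ∧ φ x / x ≤ d A

/-- `u ∈ 𝒰_ω` is an input, `y` the resulting output of the Lur'e system, and `y'` its periodic
steady state. -/
def IsResponse {T : ℝ} (hT : 0 < T) (G : ℂ → ℂ) (φ : ℝ → ℝ) (u y y' : ℝ → ℝ) : Prop :=
  IsOddHarmonicSignal hT u ∧ ∃ e e' : ℝ → ℝ,
    IsLoop G φ u e y ∧ IsSteadyState T e e' ∧ IsSteadyState T y y'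

/-- The gain `λ_{ω,A}`: the least `l` with `‖ỹ‖_T ≤ l ‖u‖_T` whenever `u ∈ 𝒰_ω` and
`‖ỹ‖_∞ ≤ A`. -/
def gainLambda {T : ℝ} (hT : 0 < T) (G : ℂ → ℂ) (φ : ℝ → ℝ) (A : ℝ) : ℝ≥0∞ :=
  sInf {l | ∀ u y y' : ℝ → ℝ, IsResponse hT G φ u y y' → normSup y' ≤ ENNReal.ofReal A →
    normT T y' ≤ l * normT T u}

/-- The gain `λ^∂_{ω,A}`: the least `l` with `‖ỹ'‖_T ≤ l ‖u'‖_T` whenever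
`u ∈ 𝒰_ω ∩ H¹[0, T]` and `‖ỹ‖_∞ ≤ A`. -/
def gainLambdaDeriv {T : ℝ} (hT : 0 < T) (G : ℂ → ℂ) (φ : ℝ → ℝ) (A : ℝ) : ℝ≥0∞ :=
  sInf {l | ∀ u y y' : ℝ → ℝ, IsResponse hT G φ u y y' → normSup y' ≤ ENNReal.ofReal A →
    ∀ du : ℝ → ℝ, IsH1WithDeriv T u du →
      ∃ dy : ℝ → ℝ, IsH1WithDeriv T y' dy ∧ normT T dy ≤ l * normT T du}

/-! ### Scaled graphs -/

/-- The scaled graph over `U` of a relation `R` on a real Hilbert space. For a linear `R` and a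
linear subspace `U` it coincides with the scaled relative graph. -/
def scaledGraph {H : Type*} [NormedAddCommGroup H] [InnerProductSpace ℝ H]
    (U : Set H) (R : Set (H × H)) : Set ℂ :=
  {z | ∃ u ∈ U, u ≠ 0 ∧ ∃ y, (u, y) ∈ R ∧
    (z = ((‖y‖ / ‖u‖ : ℝ) : ℂ) * Complex.exp (Complex.I * (InnerProductGeometry.angle u y : ℂ)) ∨
     z = ((‖y‖ / ‖u‖ : ℝ) : ℂ) *
      Complex.exp (-(Complex.I * (InnerProductGeometry.angle u y : ℂ))))}

/-- `SRG_{𝒰_ω}(G)`. -/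
def srgLTI {T : ℝ} (hT : 0 < T) (G : ℂ → ℂ) : Set ℂ :=
  scaledGraph (oddHarmonics hT) (steadyStateMap hT G)

/-- The inverse `S⁻¹ ⊆ ℂ ∪ {∞}` of a set `S ⊆ ℂ`, with `0⁻¹ = ∞`. -/
def invSet (S : Set ℂ) : Set (OnePoint ℂ) :=
  {w | ∃ z ∈ S, (z = 0 ∧ w = OnePoint.infty) ∨ (z ≠ 0 ∧ w = ((z⁻¹ : ℂ) : OnePoint ℂ))}

/-- The distance `|z - w|` in `ℂ ∪ {∞}`, with `|∞ - ∞| = 0` and `|∞ - z| = ∞`. -/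
def extDist : OnePoint ℂ → OnePoint ℂ → ℝ≥0∞
  | none, none => 0
  | none, some _ => ⊤
  | some _, none => ⊤
  | some z, some w => edist z w

/-- The distance between two subsets of `ℂ ∪ {∞}`. -/
def setDist (S₁ S₂ : Set (OnePoint ℂ)) : ℝ≥0∞ := ⨅ z ∈ S₁, ⨅ w ∈ S₂, extDist z w

/-- The closed disk `D_{[α, β]}` centred on `ℝ` that meets `ℝ` in `[α, β]`. -/
def disk (α β : ℝ) : Set ℂ := Metric.closedBall (((α + β) / 2 : ℝ) : ℂ) ((β - α) / 2)

/-- `dist(SRG_{𝒰_ω}(G)⁻¹, -D_{[α, β]})`. -/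
def margin {T : ℝ} (hT : 0 < T) (G : ℂ → ℂ) (α β : ℝ) : ℝ≥0∞ :=
  setDist (invSet (srgLTI hT G)) ((fun z : ℂ => (z : OnePoint ℂ)) '' (-disk α β))

end

end Lure

namespace Lure

/-! The periodic steady state solves the loop equations again: the Fourier coefficients of `y'` are
`G(jkω)` times those of `e'` (`fourierCoeffOn_steadyState_output`), and `u = e' + φ(y')`
(`steadyState_loop_eq`). Hence `(e', y')` lies on the graph of the steady-state map, and its
scaled-graph point `z` satisfies `‖z⁻¹ + m‖ ‖y'‖ = ‖e' + m y'‖` for every real `m`. Let `m` be the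
midpoint and `ρ` the half-length of the sector. Distance at least `r` from `z⁻¹` to the reflected
disk gives `‖e' + m y'‖ ≥ (ρ + r) ‖y'‖` (`le_norm_add_of_le_setDist`), while the sector bound gives
`‖φ(y') - m y'‖ ≤ ρ ‖y'‖`. Since `u` is the sum of these two signals, the triangle inequality leaves
`r ‖y'‖ ≤ ‖u‖` (`normT_le_of_le_margin`).

For derivatives the same inequality is applied to the increments `f(t + s) - f(t)`: the steady-state
map is linear and shift-invariant, and the slope bounds are a sector bound for increments. An `H¹`
input has increments of norm at most `s ‖u'‖` (`normT_shift_sub_le`), and an output whose increments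
are `O(s)` is weakly differentiable with the same constant (`exists_isH1WithDeriv_of_shift_le`). No
chain rule for `φ` is needed.

The analytic work is the relation between the Fourier coefficients, because `G` acts through Laplace
transforms on `Re s > 0`. Multiply by `1 - e^{-sT}` and let `s` tend to `jkω` from the right: a
periodic signal leaves its Fourier integral over one period, a signal that converges to zero leaves
nothing, and `G` is continuous at `jkω`. -/

open FourierTransform in
/-- Plancherel's theorem for functions in `L¹ ∩ L²`. -/
theorem eLpNorm_fourier_eq {f : ℝ → ℂ} (h1 : Integrable f) (h2 : MemLp f 2) :
    eLpNorm (𝓕 f) 2 volume = eLpNorm f 2 volume := by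
  have hcont : Continuous (𝓕 f) :=
    VectorFourier.fourierIntegral_continuous Real.continuous_fourierChar
      (by fun_prop) h1
  -- The transform on `L²` and the Fourier integral are identified by testing: against a smooth
  -- compactly supported function both move the transform onto the test function, the first as a
  -- tempered distribution, the second by Fubini.
  have key : (𝓕 (h2.toLp f) : Lp ℂ 2 (volume : Measure ℝ)) =ᵐ[volume] 𝓕 f := by
    refine ae_eq_of_integral_contDiff_smul_eq
      ((Lp.memLp _).locallyIntegrable (by norm_num)) hcont.locallyIntegrable ?_
    intro g g_smooth g_cpt
    have hg₁ : HasCompactSupport (Complex.ofRealCLM ∘ g) := g_cpt.comp_left rfl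
    have hg₂ : ContDiff ℝ ((⊤ : ℕ∞) : WithTop ℕ∞) (Complex.ofRealCLM ∘ g) := by fun_prop
    set ψ : SchwartzMap ℝ ℂ := hg₁.toSchwartzMap hg₂ with hψ
    have hψv : ∀ x, ψ x = (g x : ℂ) := fun x => rfl
    have e1 := congrArg (fun d => d ψ) (Lp.fourier_toTemperedDistribution_eq (h2.toLp f))
    simp only [TemperedDistribution.fourier_apply, Lp.toTemperedDistribution_apply] at e1
    have e2 : ∫ x, (𝓕 ψ) x • (h2.toLp f : ℝ → ℂ) x = ∫ x, (𝓕 ψ) x • f x := by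
      refine integral_congr_ae ?_
      filter_upwards [h2.coeFn_toLp] with x hx
      rw [hx]
    have e3 := VectorFourier.integral_fourierIntegral_smul_eq_flip (L := innerₗ ℝ)
      (μ := volume) (ν := volume) Real.continuous_fourierChar (by fun_prop) ψ.integrable h1
    have e4 : ∫ x, (𝓕 ψ) x • f x = ∫ x, ψ x • (𝓕 f) x := by
      rw [flip_innerₗ] at e3
      exact e3
    have e5 : ∀ v : ℝ → ℂ, ∫ x, g x • v x = ∫ x, ψ x • v x := by
      intro v
      refine integral_congr_ae (ae_of_all _ fun x => ?_)
      simp [hψv]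
    rw [e5, e5, ← e4, ← e2, e1]
  rw [← eLpNorm_congr_ae key, ← eLpNorm_congr_ae h2.coeFn_toLp]
  have := Lp.norm_fourier_eq (h2.toLp f)
  rw [Lp.norm_def, Lp.norm_def] at this
  exact (ENNReal.toReal_eq_toReal_iff' (Lp.eLpNorm_ne_top _) (Lp.eLpNorm_ne_top _)).1 this

/-! ### Exponentially weighted signals -/

/-- `e^{-σt} u(t)` has finite energy for every `σ > 0`. -/
def IsExpL2 (u : ℝ → ℝ) : Prop :=
  ∀ σ : ℝ, 0 < σ → MemLp (fun t => Real.exp (-σ * t) * u t) 2 timeAxis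

/-- The norm of `e^{-σt} u(t)` in `L₂[0, ∞)`. -/
noncomputable def expNorm (σ : ℝ) (u : ℝ → ℝ) : ℝ≥0∞ :=
  eLpNorm (fun t => Real.exp (-σ * t) * u t) 2 timeAxis

theorem ae_timeAxis_nonneg : ∀ᵐ t ∂timeAxis, 0 ≤ t :=
  ae_restrict_mem measurableSet_Ici

theorem memLp_exp_two {σ : ℝ} (hσ : 0 < σ) :
    MemLp (fun t : ℝ => Real.exp (-σ * t)) 2 timeAxis := by
  rw [memLp_two_iff_integrable_sq (by fun_prop)]
  have h : (fun t : ℝ => Real.exp (-σ * t) ^ 2) = fun t => Real.exp (-(2 * σ) * t) := by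
    ext t
    rw [← Real.exp_nat_mul]
    congr 1
    push_cast
    ring
  rw [h, timeAxis]
  exact (integrableOn_Ici_iff_integrableOn_Ioi).2 (exp_neg_integrableOn_Ioi 0 (by positivity))

theorem exp_neg_mul_split (σ t x : ℝ) :
    Real.exp (-σ * t) * x = Real.exp (-(σ / 2) * t) * (Real.exp (-(σ / 2) * t) * x) := by
  rw [← mul_assoc, ← Real.exp_add]
  ring_nf

theorem IsExpL2.integrable {u : ℝ → ℝ} (hu : IsExpL2 u) {σ : ℝ} (hσ : 0 < σ) :
    Integrable (fun t => Real.exp (-σ * t) * u t) timeAxis := by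
  have h := (memLp_exp_two (half_pos hσ)).integrable_mul (hu (σ / 2) (half_pos hσ))
  refine h.congr (ae_of_all _ fun t => ?_)
  simp only [Pi.mul_apply]
  exact (exp_neg_mul_split σ t (u t)).symm

theorem IsExpL2.expNorm_ne_top {u : ℝ → ℝ} (hu : IsExpL2 u) {σ : ℝ} (hσ : 0 < σ) :
    expNorm σ u ≠ ⊤ :=
  (hu σ hσ).eLpNorm_ne_top

theorem norm_exp_neg_mul (s : ℂ) (t x : ℝ) :
    ‖Complex.exp (-s * t) * (x : ℂ)‖ = ‖Real.exp (-s.re * t) * x‖ := by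
  rw [norm_mul, norm_mul, Complex.norm_exp, Complex.norm_real, Real.norm_eq_abs (Real.exp _),
    Real.abs_exp]
  simp

theorem IsExpL2.aestronglyMeasurable {u : ℝ → ℝ} (hu : IsExpL2 u) :
    AEStronglyMeasurable u timeAxis := by
  have h : AEStronglyMeasurable (fun t : ℝ => Real.exp t) timeAxis :=
    Real.continuous_exp.aestronglyMeasurable
  refine (h.mul (hu 1 one_pos).aestronglyMeasurable).congr (ae_of_all _ fun t => ?_)
  simp only [Pi.mul_apply]
  rw [← mul_assoc, ← Real.exp_add]
  simp

theorem IsExpL2.integrable_laplace {u : ℝ → ℝ} (hu : IsExpL2 u) {s : ℂ} (hs : 0 < s.re) :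
    Integrable (fun t : ℝ => Complex.exp (-s * t) * (u t : ℂ)) timeAxis := by
  refine (hu.integrable hs).mono ?_ (ae_of_all _ fun t => (norm_exp_neg_mul s t (u t)).le)
  exact (Continuous.aestronglyMeasurable (by fun_prop)).mul
    (Complex.continuous_ofReal.comp_aestronglyMeasurable hu.aestronglyMeasurable)

theorem IsExpL2.sub {u v : ℝ → ℝ} (hu : IsExpL2 u) (hv : IsExpL2 v) :
    IsExpL2 (fun t => u t - v t) := by
  intro σ hσ
  refine ((hu σ hσ).sub (hv σ hσ)).ae_eq (ae_of_all _ fun t => ?_)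
  simp [mul_sub]

theorem IsExpL2.add {u v : ℝ → ℝ} (hu : IsExpL2 u) (hv : IsExpL2 v) :
    IsExpL2 (fun t => u t + v t) := by
  intro σ hσ
  refine ((hu σ hσ).add (hv σ hσ)).ae_eq (ae_of_all _ fun t => ?_)
  simp [mul_add]

theorem IsExpL2.mono {u v : ℝ → ℝ} (hu : IsExpL2 u) (hv : AEStronglyMeasurable v timeAxis)
    (h : ∀ᵐ t ∂timeAxis, |v t| ≤ |u t|) : IsExpL2 v := by
  intro σ hσ
  refine (hu σ hσ).mono ((Continuous.aestronglyMeasurable (by fun_prop)).mul hv) ?_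
  filter_upwards [h] with t ht
  rw [norm_mul, norm_mul]
  exact mul_le_mul_of_nonneg_left ht (norm_nonneg _)

theorem expNorm_mono {u v : ℝ → ℝ} (σ : ℝ) (h : ∀ᵐ t ∂timeAxis, |v t| ≤ |u t|) :
    expNorm σ v ≤ expNorm σ u := by
  refine eLpNorm_mono_ae ?_
  filter_upwards [h] with t ht
  rw [norm_mul, norm_mul]
  exact mul_le_mul_of_nonneg_left ht (norm_nonneg _)

theorem expNorm_sub_le {u v : ℝ → ℝ} (hu : IsExpL2 u) (hv : IsExpL2 v) {σ : ℝ} (hσ : 0 < σ) :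
    expNorm σ (fun t => u t - v t) ≤ expNorm σ u + expNorm σ v := by
  have h := eLpNorm_sub_le (p := 2) (hu σ hσ).aestronglyMeasurable
    (hv σ hσ).aestronglyMeasurable (by norm_num)
  refine le_trans (le_of_eq ?_) h
  unfold expNorm
  congr 1
  ext t
  simp [mul_sub]

theorem isExpL2_of_bounded {u : ℝ → ℝ} (hm : AEStronglyMeasurable u timeAxis) {C : ℝ}
    (h : ∀ᵐ t ∂timeAxis, |u t| ≤ C) : IsExpL2 u := by
  have hC : IsExpL2 (fun _ => C) := fun σ hσ => (memLp_exp_two hσ).mul_const C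
  refine hC.mono hm ?_
  filter_upwards [h] with t ht
  exact ht.trans (le_abs_self C)

theorem IsL2.isExpL2 {u : ℝ → ℝ} (hu : IsL2 u) : IsExpL2 u := by
  intro σ hσ
  refine MemLp.mono hu ((Continuous.aestronglyMeasurable (by fun_prop)).mul
    hu.aestronglyMeasurable) ?_
  filter_upwards [ae_timeAxis_nonneg] with t ht
  rw [norm_mul, Real.norm_eq_abs (Real.exp _), Real.abs_exp]
  refine mul_le_of_le_one_left (norm_nonneg _) (Real.exp_le_one_iff.2 ?_)
  nlinarith

theorem laplace_sub {u v : ℝ → ℝ} (hu : IsExpL2 u) (hv : IsExpL2 v) {s : ℂ} (hs : 0 < s.re) :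
    laplace (fun t => u t - v t) s = laplace u s - laplace v s := by
  unfold laplace
  rw [← integral_sub (hu.integrable_laplace hs) (hv.integrable_laplace hs)]
  refine integral_congr_ae (ae_of_all _ fun t => ?_)
  simp [mul_sub]

theorem ae_timeAxis_of_horizon {T : ℝ} {p : ℝ → Prop} (h : ∀ᵐ t ∂horizon T, p t) :
    ∀ᵐ t ∂timeAxis, t ≤ T → p t := by
  unfold horizon at h
  unfold timeAxis
  rw [ae_restrict_iff' measurableSet_Icc] at h
  rw [ae_restrict_iff' measurableSet_Ici]
  filter_upwards [h] with t ht h0 hT using ht ⟨h0, hT⟩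

/-- Only `t > T` contributes. There half of the decay rate yields the factor `e^{-Re(s) T/2}`; the
other half is split into two quarters for Cauchy–Schwarz. This controls the error made by truncating
at `T`. -/
theorem enorm_laplace_le_of_horizon_eq_zero {u : ℝ → ℝ} (hu : IsExpL2 u) {s : ℂ}
    (hs : 0 < s.re) {T : ℝ} (h : ∀ᵐ t ∂horizon T, u t = 0) :
    ‖laplace u s‖ₑ ≤ ENNReal.ofReal (Real.exp (-(s.re / 2) * T)) *
      (eLpNorm (fun t : ℝ => Real.exp (-(s.re / 2 / 2) * t)) 2 timeAxis *
        expNorm (s.re / 2 / 2) u) := by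
  have h4 : 0 < s.re / 2 / 2 := by positivity
  have hold := eLpNorm_smul_le_mul_eLpNorm (p := 2) (q := 2) (r := 1)
    (hu (s.re / 2 / 2) h4).aestronglyMeasurable (memLp_exp_two h4).aestronglyMeasurable
  refine le_trans ?_ (mul_le_mul_right hold _)
  refine (enorm_integral_le_lintegral_enorm _).trans ?_
  rw [eLpNorm_one_eq_lintegral_enorm, ← lintegral_const_mul' _ _ ENNReal.ofReal_ne_top]
  refine lintegral_mono_ae ?_
  filter_upwards [ae_timeAxis_of_horizon h] with t ht
  have hc : ENNReal.ofReal (Real.exp (-(s.re / 2) * T)) =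
      ‖Real.exp (-(s.re / 2) * T)‖ₑ := (Real.enorm_of_nonneg (Real.exp_pos _).le).symm
  rw [hc, ← enorm_mul]
  rw [← ofReal_norm (_ : ℂ), ← ofReal_norm (_ : ℝ)]
  refine ENNReal.ofReal_le_ofReal ?_
  rw [norm_exp_neg_mul]
  simp only [Pi.smul_apply', smul_eq_mul]
  rw [← exp_neg_mul_split, exp_neg_mul_split s.re, norm_mul (Real.exp (-(s.re / 2) * t)),
    norm_mul (Real.exp (-(s.re / 2) * T))]
  rcases le_or_gt t T with h1 | h1
  · simp [ht h1]
  · refine mul_le_mul_of_nonneg_right ?_ (norm_nonneg _)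
    rw [Real.norm_eq_abs, Real.abs_exp, Real.norm_eq_abs, Real.abs_exp, Real.exp_le_exp]
    nlinarith

/-! ### Plancherel on vertical lines and the transfer function relation -/

open FourierTransform in
theorem fourier_exp_eq_laplace (u : ℝ → ℝ) (σ ξ : ℝ) :
    𝓕 ((Set.Ici (0 : ℝ)).indicator fun t => ((Real.exp (-σ * t) * u t : ℝ) : ℂ)) ξ =
      laplace u (σ + 2 * Real.pi * ξ * Complex.I) := by
  rw [Real.fourier_real_eq_integral_exp_smul, laplace, timeAxis,
    ← integral_indicator measurableSet_Ici]
  congr 1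
  ext t
  by_cases ht : t ∈ Set.Ici (0 : ℝ)
  · simp only [Set.indicator_of_mem ht, smul_eq_mul]
    push_cast
    rw [← mul_assoc, ← Complex.exp_add]
    ring_nf
  · simp [Set.indicator_of_notMem ht]

-- On the line `Re s = σ` the Laplace transform is the Fourier transform of `e^{-σt} u(t)`;
-- parametrising by `2πξ` makes the constant in Plancherel's theorem equal to one.
open FourierTransform in
theorem eLpNorm_laplace {u : ℝ → ℝ} (hu : IsExpL2 u) {σ : ℝ} (hσ : 0 < σ) :
    eLpNorm (fun ξ : ℝ => laplace u (σ + 2 * Real.pi * ξ * Complex.I)) 2 volume =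
      expNorm σ u := by
  have e : (fun ξ : ℝ => laplace u (σ + 2 * Real.pi * ξ * Complex.I)) =
      𝓕 ((Set.Ici (0 : ℝ)).indicator fun t => ((Real.exp (-σ * t) * u t : ℝ) : ℂ)) := by
    ext ξ
    exact (fourier_exp_eq_laplace u σ ξ).symm
  have h1 : Integrable (fun t => ((Real.exp (-σ * t) * u t : ℝ) : ℂ)) timeAxis :=
    (hu.integrable hσ).ofReal
  have h2 : MemLp (fun t => ((Real.exp (-σ * t) * u t : ℝ) : ℂ)) 2 timeAxis := (hu σ hσ).ofReal
  rw [e, eLpNorm_fourier_eq ((integrable_indicator_iff measurableSet_Ici).2 h1)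
    ((memLp_indicator_iff_restrict measurableSet_Ici).2 h2),
    eLpNorm_indicator_eq_eLpNorm_restrict measurableSet_Ici]
  refine eLpNorm_congr_norm_ae (ae_of_all _ fun t => ?_)
  rw [Complex.norm_real]

theorem expNorm_le_of_laplace_eq {G : ℂ → ℂ} {M : ℝ} (hM : ∀ s : ℂ, 0 ≤ s.re → ‖G s‖ ≤ M)
    {x z : ℝ → ℝ} (hx : IsExpL2 x) (hz : IsExpL2 z)
    (h : ∀ s : ℂ, 0 < s.re → laplace z s = G s * laplace x s) {σ : ℝ} (hσ : 0 < σ) :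
    expNorm σ z ≤ ENNReal.ofReal M * expNorm σ x := by
  rw [← eLpNorm_laplace hx hσ, ← eLpNorm_laplace hz hσ]
  refine eLpNorm_le_mul_eLpNorm_of_ae_le_mul (ae_of_all _ fun ξ => ?_) 2
  have hre : ((σ : ℂ) + 2 * Real.pi * ξ * Complex.I).re = σ := by simp
  rw [h _ (by rw [hre]; exact hσ), norm_mul]
  exact mul_le_mul_of_nonneg_right (hM _ (by rw [hre]; exact hσ.le)) (norm_nonneg _)

/-- `IsOutput` gives the relation only for truncated inputs. The tails of input and output beyond
`T` contribute `e^{-Re(s) T/2}` times a constant that does not depend on `T`, because the weighted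
gain of `G` is at most `M` whatever the truncation; so the defect vanishes as `T → ∞`. -/
theorem laplace_eq_of_isOutput {G : ℂ → ℂ} {M : ℝ} (hM : ∀ s : ℂ, 0 ≤ s.re → ‖G s‖ ≤ M)
    {e y : ℝ → ℝ} (h : IsOutput G e y) (he : IsExpL2 e) (hy : IsExpL2 y) {s : ℂ}
    (hs : 0 < s.re) : laplace y s = G s * laplace e s := by
  obtain ⟨-, -, hout⟩ := h
  -- The quarter rate at which the tail estimate measures the weighted norms.
  set σ := s.re / 2 / 2 with hσdef
  have hσ : 0 < σ := by positivity
  set K := eLpNorm (fun t : ℝ => Real.exp (-σ * t)) 2 timeAxis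
  have hK : K ≠ ⊤ := (memLp_exp_two hσ).eLpNorm_ne_top
  set B := K * (expNorm σ y + ENNReal.ofReal M * expNorm σ e) +
    ‖G s‖ₑ * (K * expNorm σ e) with hB
  have hBtop : B ≠ ⊤ := by
    have h1 := hy.expNorm_ne_top hσ
    have h2 := he.expNorm_ne_top hσ
    finiteness
  have bound : ∀ T : ℝ, 0 ≤ T → ‖laplace y s - G s * laplace e s‖ₑ ≤
      ENNReal.ofReal (Real.exp (-(s.re / 2) * T)) * B := by
    intro T hT
    obtain ⟨z, hzL, hzlap, hyz⟩ := hout T hT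
    have hz := hzL.isExpL2
    have habs : ∀ t, |truncate T e t| ≤ |e t| := by
      intro t
      unfold truncate
      by_cases ht : t ∈ Set.Iic T
      · simp [Set.indicator_of_mem ht]
      · simp [Set.indicator_of_notMem ht]
    have habs' : ∀ t, |e t - truncate T e t| ≤ |e t| := by
      intro t
      unfold truncate
      by_cases ht : t ∈ Set.Iic T
      · simp [Set.indicator_of_mem ht]
      · simp [Set.indicator_of_notMem ht]
    have htr : IsExpL2 (truncate T e) :=
      he.mono (he.aestronglyMeasurable.indicator measurableSet_Iic) (ae_of_all _ habs)
    have hd1 := enorm_laplace_le_of_horizon_eq_zero (hy.sub hz) hs (T := T)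
      (by filter_upwards [hyz] with t ht; rw [ht, sub_self])
    have hd2 := enorm_laplace_le_of_horizon_eq_zero (he.sub htr) hs (T := T) (by
      unfold horizon
      filter_upwards [ae_restrict_mem measurableSet_Icc] with t ht
      unfold truncate
      rw [Set.indicator_of_mem (show t ∈ Set.Iic T from ht.2), sub_self])
    rw [laplace_sub hy hz hs] at hd1
    rw [laplace_sub he htr hs] at hd2
    have hn1 : expNorm σ (fun t => y t - z t) ≤
        expNorm σ y + ENNReal.ofReal M * expNorm σ e := by
      refine (expNorm_sub_le hy hz hσ).trans (add_le_add le_rfl ?_)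
      refine (expNorm_le_of_laplace_eq hM htr hz hzlap hσ).trans ?_
      exact mul_le_mul_right (expNorm_mono σ (ae_of_all _ habs)) _
    have hn2 : expNorm σ (fun t => e t - truncate T e t) ≤ expNorm σ e :=
      expNorm_mono σ (ae_of_all _ habs')
    have key : laplace y s - G s * laplace e s = (laplace y s - laplace z s) -
        G s * (laplace e s - laplace (truncate T e) s) := by
      rw [hzlap s hs]
      ring
    rw [key]
    refine enorm_sub_le.trans ?_
    rw [enorm_mul, hB, mul_add]
    refine add_le_add (hd1.trans ?_) ((mul_le_mul_right hd2 _).trans ?_)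
    · gcongr
    · rw [mul_left_comm]
      gcongr
  have hlim : Tendsto (fun T : ℝ => ENNReal.ofReal (Real.exp (-(s.re / 2) * T)) * B) atTop
      (nhds 0) := by
    have h1 : Tendsto (fun T : ℝ => Real.exp (-(s.re / 2) * T)) atTop (nhds 0) := by
      refine Real.tendsto_exp_atBot.comp ?_
      exact tendsto_id.const_mul_atTop_of_neg (by linarith)
    have h2 := ENNReal.tendsto_ofReal h1
    rw [ENNReal.ofReal_zero] at h2
    simpa using ENNReal.Tendsto.mul_const h2 (Or.inr hBtop)
  have h0 : ‖laplace y s - G s * laplace e s‖ₑ ≤ 0 :=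
    ge_of_tendsto hlim (by filter_upwards [eventually_ge_atTop 0] with T hT using bound T hT)
  rw [nonpos_iff_eq_zero, enorm_eq_zero] at h0
  exact sub_eq_zero.1 h0

/-- Properness bounds `G` outside a ball; inside, the closed half-disk is compact and `G` is
continuous on it. -/
theorem IsProperStable.exists_bound {G : ℂ → ℂ} (hG : IsProperStable G) :
    ∃ M : ℝ, ∀ s : ℂ, 0 ≤ s.re → ‖G s‖ ≤ M := by
  obtain ⟨ρ, M, hM⟩ := hG.proper
  have hK : IsCompact (Metric.closedBall (0 : ℂ) ρ ∩ {s : ℂ | 0 ≤ s.re}) :=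
    (isCompact_closedBall 0 ρ).inter_right (isClosed_le continuous_const Complex.continuous_re)
  obtain ⟨C, hC⟩ := hK.exists_bound_of_continuousOn (f := G)
    fun s hs => (hG.stable s hs.2).continuousAt.continuousWithinAt
  refine ⟨max M C, fun s hs => ?_⟩
  rcases le_total ρ ‖s‖ with h | h
  · exact (hM s hs h).trans (le_max_left _ _)
  · exact (hC s ⟨by simpa using h, hs⟩).trans (le_max_right _ _)

/-! ### Almost-everywhere periodicity and the energy of periodic signals -/

theorem ae_timeAxis_iff {p : ℝ → Prop} :
    (∀ᵐ t ∂timeAxis, p t) ↔ ∀ᵐ t : ℝ, 0 ≤ t → p t := by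
  unfold timeAxis
  rw [ae_restrict_iff' measurableSet_Ici]
  rfl

theorem ae_comp_add_right {p : ℝ → Prop} (h : ∀ᵐ t : ℝ, p t) (c : ℝ) : ∀ᵐ t : ℝ, p (t + c) :=
  (measurePreserving_add_right volume c).quasiMeasurePreserving.ae h

theorem ae_timeAxis_shift {p : ℝ → Prop} (h : ∀ᵐ t ∂timeAxis, p t) {c : ℝ} (hc : 0 ≤ c) :
    ∀ᵐ t ∂timeAxis, p (t + c) := by
  rw [ae_timeAxis_iff] at h ⊢
  filter_upwards [ae_comp_add_right h c] with t ht h0 using ht (by positivity)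

theorem ae_horizon_of_timeAxis {p : ℝ → Prop} (h : ∀ᵐ t ∂timeAxis, p t) (T : ℝ) :
    ∀ᵐ t ∂horizon T, p t :=
  ae_restrict_of_ae_restrict_of_subset (fun _ ht => ht.1) h

/-- A signal that is periodic on `[0, ∞)` has a representative that is periodic on `ℝ`. -/
theorem exists_periodic_ae_eq {T : ℝ} (hT : 0 < T) {f : ℝ → ℝ}
    (h : ∀ᵐ t ∂timeAxis, f (t + T) = f t) :
    ∃ p : ℝ → ℝ, Function.Periodic p T ∧ ∀ᵐ t ∂timeAxis, p t = f t := by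
  refine ⟨fun t => f (toIcoMod hT 0 t), fun t => by simp, ?_⟩
  rw [ae_timeAxis_iff] at h ⊢
  have key : ∀ n : ℕ, ∀ᵐ t : ℝ, n * T ≤ t → f t = f (t - n * T) := by
    intro n
    induction n with
    | zero => simp
    | succ n ih =>
      filter_upwards [ih, ae_comp_add_right h (-((n + 1) * T))] with t h1 h2 ht
      push_cast at ht ⊢
      rw [h1 (by nlinarith), show t - n * T = t + -((n + 1) * T) + T by ring, h2 (by linarith)]
      congr 1
  filter_upwards [ae_all_iff.2 key] with t ht h0
  have h1 : (0 : ℤ) ≤ toIcoDiv hT 0 t := by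
    have h2 := toIcoMod_mem_Ico hT 0 t
    have h3 := toIcoMod_add_toIcoDiv_zsmul hT 0 t
    by_contra hneg
    have h4 : (toIcoDiv hT 0 t : ℝ) ≤ -1 := by exact_mod_cast (by omega : toIcoDiv hT 0 t ≤ -1)
    rw [zsmul_eq_mul] at h3
    have h5 := h2.2
    nlinarith
  obtain ⟨n, hn⟩ := Int.eq_ofNat_of_zero_le h1
  have h2 := toIcoMod_mem_Ico hT 0 t
  have h3 := toIcoMod_add_toIcoDiv_zsmul hT 0 t
  rw [hn, zsmul_eq_mul] at h3
  push_cast at h3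
  have h6 := h2.1
  rw [ht n (by linarith)]
  congr 1
  linarith

theorem IsHalfWavePeriodic.periodic {T : ℝ} (hT : 0 < T) {f : ℝ → ℝ}
    (h : IsHalfWavePeriodic T f) : ∀ᵐ t ∂timeAxis, f (t + T) = f t := by
  filter_upwards [h, ae_timeAxis_shift h (half_pos hT).le] with t h1 h2
  rw [show t + T = t + T / 2 + T / 2 by ring, h2, h1, neg_neg]

/-- A periodic property that holds eventually holds almost everywhere. -/
theorem ae_timeAxis_of_periodic_of_eventually {T : ℝ} (hT : 0 < T) {P : ℝ → Prop}
    (hper : ∀ᵐ t ∂timeAxis, P (t + T) → P t) {t₀ : ℝ} (h : ∀ᵐ t ∂timeAxis, t₀ ≤ t → P t) :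
    ∀ᵐ t ∂timeAxis, P t := by
  have key : ∀ n : ℕ, ∀ᵐ t ∂timeAxis, P (t + n * T) → P t := by
    intro n
    induction n with
    | zero => simp
    | succ n ih =>
      filter_upwards [ih, ae_timeAxis_shift hper (c := n * T) (by positivity)] with t h1 h2 h3
      refine h1 (h2 ?_)
      convert h3 using 1
      push_cast
      ring
  obtain ⟨n, hn⟩ := exists_nat_ge (t₀ / T)
  rw [div_le_iff₀ hT] at hn
  filter_upwards [key n, ae_timeAxis_shift h (c := n * T) (by positivity), ae_timeAxis_nonneg]
    with t h1 h2 h3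
  exact h1 (h2 (by linarith))

/-- Geometric series: the integrals over `[0, nT]` satisfy `I (n+1) = a + q I n` with `q = e^{-σT} <
1`, and are bounded by the fixed point `a / (1 - q)`. -/
theorem integrableOn_exp_mul_of_periodic {T : ℝ} (hT : 0 < T) {g : ℝ → ℝ}
    (hg : Function.Periodic g T) (hg0 : ∀ t, 0 ≤ g t)
    (hint : ∀ R : ℝ, IntervalIntegrable g volume 0 R) {σ : ℝ} (hσ : 0 < σ) :
    IntegrableOn (fun t => Real.exp (-σ * t) * g t) (Set.Ioi 0) := by
  set F : ℝ → ℝ := fun t => Real.exp (-σ * t) * g t with hF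
  have hFint : ∀ R : ℝ, IntervalIntegrable F volume 0 R := fun R =>
    (hint R).continuousOn_mul (by fun_prop)
  have hFn : ∀ t, ‖F t‖ = F t := fun t => by
    rw [Real.norm_of_nonneg (mul_nonneg (Real.exp_pos _).le (hg0 t))]
  set q := Real.exp (-σ * T) with hq
  have hq1 : q < 1 := Real.exp_lt_one_iff.2 (by nlinarith)
  set a := ∫ t in (0 : ℝ)..T, F t with ha
  have ha0 : 0 ≤ a := intervalIntegral.integral_nonneg hT.le
    fun t _ => mul_nonneg (Real.exp_pos _).le (hg0 t)
  have hbound : ∀ n : ℕ, ∫ t in (0 : ℝ)..n * T, F t ≤ a / (1 - q) := by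
    intro n
    induction n with
    | zero => simpa using div_nonneg ha0 (by linarith)
    | succ n ih =>
      have hshift : ∫ t in T..((n + 1 : ℕ) : ℝ) * T, F t = q * ∫ t in (0 : ℝ)..n * T, F t := by
        have h1 := intervalIntegral.integral_comp_add_right (a := 0) (b := n * T) F T
        rw [zero_add, show (n : ℝ) * T + T = ((n + 1 : ℕ) : ℝ) * T by push_cast; ring] at h1
        rw [← h1, ← intervalIntegral.integral_const_mul]
        refine intervalIntegral.integral_congr fun t _ => ?_
        simp only [hF, hq]
        rw [hg t, ← mul_assoc, ← Real.exp_add]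
        ring_nf
      rw [← intervalIntegral.integral_add_adjacent_intervals (hFint T)
        ((hFint T).symm.trans (hFint _)), hshift]
      have h2 : a / (1 - q) = a + q * (a / (1 - q)) := by
        have : 1 - q ≠ 0 := by linarith
        field_simp
        ring
      rw [h2]
      have h3 : 0 ≤ q := (Real.exp_pos _).le
      gcongr
  refine integrableOn_Ioi_of_intervalIntegral_norm_bounded (a / (1 - q)) 0
    (b := fun n : ℕ => (n : ℝ) * T) (l := atTop) (fun n => ?_) ?_ ?_
  · exact (hFint (n * T)).1
  · exact tendsto_natCast_atTop_atTop.atTop_mul_const hT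
  · refine Eventually.of_forall fun n => ?_
    simp_rw [hFn]
    exact hbound n

theorem IsL2e.aestronglyMeasurable {f : ℝ → ℝ} (hf : IsL2e f) :
    AEStronglyMeasurable f timeAxis := by
  have h : Set.Ici (0 : ℝ) = ⋃ n : ℕ, Set.Icc (0 : ℝ) n := by
    ext t
    simp only [Set.mem_Ici, Set.mem_iUnion, Set.mem_Icc]
    exact ⟨fun h => (exists_nat_ge t).imp fun n hn => ⟨h, hn⟩, fun ⟨_, h, _⟩ => h⟩
  unfold timeAxis
  rw [h, aestronglyMeasurable_iUnion_iff]
  exact fun n => (hf n n.cast_nonneg).aestronglyMeasurable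

theorem IsL2e.isExpL2_of_periodic {T : ℝ} (hT : 0 < T) {f : ℝ → ℝ} (hf : IsL2e f)
    (hper : ∀ᵐ t ∂timeAxis, f (t + T) = f t) : IsExpL2 f := by
  obtain ⟨p, hp, hpf⟩ := exists_periodic_ae_eq hT hper
  intro σ hσ
  have hm : AEStronglyMeasurable (fun t => Real.exp (-σ * t) * f t) timeAxis :=
    (Continuous.aestronglyMeasurable (by fun_prop)).mul hf.aestronglyMeasurable
  rw [memLp_two_iff_integrable_sq hm]
  have h1 : IntegrableOn (fun t => Real.exp (-(2 * σ) * t) * p t ^ 2) (Set.Ioi 0) := by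
    refine integrableOn_exp_mul_of_periodic hT (fun t => by simp only [hp t])
      (fun t => sq_nonneg _) (fun R => ?_) (by positivity)
    have h2 : ∀ R : ℝ, 0 ≤ R → IntervalIntegrable (fun t => p t ^ 2) volume 0 R := by
      intro R hR
      rw [intervalIntegrable_iff_integrableOn_Icc_of_le hR]
      refine ((hf R hR).integrable_sq).congr ?_
      filter_upwards [ae_horizon_of_timeAxis hpf R] with t ht
      rw [ht]
    rcases le_total 0 R with hR | hR
    · exact h2 R hR
    -- For negative `R` the interval is translated by whole periods into `[0, ∞)`, where `f` is
    -- controlled.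
    · obtain ⟨n, hn⟩ := exists_nat_ge (-R / T)
      rw [div_le_iff₀ hT] at hn
      have h3 := ((h2 (n * T + R) (by linarith)).symm.trans
        (h2 (n * T) (by positivity))).comp_add_right (n * T)
      refine (IntervalIntegrable.congr (fun t _ => ?_) (by simpa using h3)).symm
      have h4 := hp.nat_mul n t
      simp only [h4]
  have h3 := (integrableOn_Ici_iff_integrableOn_Ioi).2 h1
  refine Integrable.congr h3 ?_
  filter_upwards [show ∀ᵐ t ∂timeAxis, p t = f t from hpf] with t ht
  rw [ht, mul_pow, ← Real.exp_nat_mul]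
  congr 2
  push_cast
  ring

/-- The error `y - y'` is square-integrable up to some `t₀` and bounded by `1` afterwards; both
pieces have finite weighted energy. -/
theorem isExpL2_of_convergesTo {y y' : ℝ → ℝ} (hy : IsL2e y) (hy' : IsL2e y')
    (h' : IsExpL2 y') (hc : ConvergesTo y y') : IsExpL2 y := by
  obtain ⟨t₀, ht₀, h⟩ := hc 1 one_pos
  have hm : AEStronglyMeasurable (fun t => y t - y' t) timeAxis :=
    hy.aestronglyMeasurable.sub hy'.aestronglyMeasurable
  have h1 : IsExpL2 ((Set.Iic t₀).indicator fun t => y t - y' t) := by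
    refine IsL2.isExpL2 ?_
    unfold IsL2
    rw [memLp_indicator_iff_restrict measurableSet_Iic, timeAxis,
      Measure.restrict_restrict measurableSet_Iic, Set.inter_comm, Set.Ici_inter_Iic]
    exact (hy t₀ ht₀.le).sub (hy' t₀ ht₀.le)
  have h2 : IsExpL2 ((Set.Ioi t₀).indicator fun t => y t - y' t) := by
    refine isExpL2_of_bounded (hm.indicator measurableSet_Ioi) (C := 1) ?_
    filter_upwards [h] with t ht
    by_cases htt : t ∈ Set.Ioi t₀
    · rw [Set.indicator_of_mem htt]
      exact (ht (le_of_lt htt)).le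
    · simp [Set.indicator_of_notMem htt]
  have h3 := (h'.add h1).add h2
  refine h3.mono hy.aestronglyMeasurable (ae_of_all _ fun t => le_of_eq ?_)
  rcases le_or_gt t t₀ with htt | htt
  · rw [Set.indicator_of_mem (show t ∈ Set.Iic t₀ from htt),
      Set.indicator_of_notMem (show t ∉ Set.Ioi t₀ from not_lt.2 htt)]
    simp
  · rw [Set.indicator_of_notMem (show t ∉ Set.Iic t₀ from not_le.2 htt),
      Set.indicator_of_mem (show t ∈ Set.Ioi t₀ from htt)]
    simp

/-! ### Boundary behaviour of Laplace transforms at the harmonics -/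

theorem integral_timeAxis_eq {E : Type*} [NormedAddCommGroup E] [NormedSpace ℝ E] (f : ℝ → E) :
    ∫ t, f t ∂timeAxis = ∫ t in Set.Ioi 0, f t :=
  integral_Ici_eq_integral_Ioi

/-- By periodicity the integral over `[T, ∞)` is `e^{-sT}` times the whole transform. -/
theorem laplace_of_periodic {T : ℝ} (hT : 0 < T) {f : ℝ → ℝ} (hf : IsExpL2 f)
    (hper : ∀ᵐ t ∂timeAxis, f (t + T) = f t) {s : ℂ} (hs : 0 < s.re) :
    (1 - Complex.exp (-s * T)) * laplace f s =
      ∫ t in (0 : ℝ)..T, Complex.exp (-s * t) * (f t : ℂ) := by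
  set g : ℝ → ℂ := fun t => Complex.exp (-s * t) * (f t : ℂ) with hg
  have hint : IntegrableOn g (Set.Ioi 0) :=
    (integrableOn_Ici_iff_integrableOn_Ioi).1 (hf.integrable_laplace hs)
  have hl : laplace f s = ∫ t in Set.Ioi 0, g t := integral_timeAxis_eq _
  have hsplit := intervalIntegral.integral_Ioi_sub_Ioi hint hT.le
  have hshift : ∫ t in Set.Ioi T, g t = Complex.exp (-s * T) * laplace f s := by
    have h1 := (measurePreserving_add_right volume T).setIntegral_preimage_emb
      (measurableEmbedding_addRight T) g (Set.Ioi T)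
    rw [Set.preimage_add_const_Ioi, sub_self] at h1
    rw [← h1, laplace, ← integral_const_mul, ← integral_timeAxis_eq]
    refine integral_congr_ae ?_
    filter_upwards [hper] with t ht
    simp only [hg]
    rw [ht, ← mul_assoc, ← Complex.exp_add]
    push_cast
    ring_nf
  rw [← hsplit, hshift, ← hl]
  ring

/-- An Abelian estimate: if `|f|` is below `δ` after `t₀`, the transform is at most `C + δ/σ`, while
the prefactor is at most `σT`. The product is at most `σTC + δT`, and `δ = ε/(2T)` makes the second
term `ε/2`. -/
theorem tendsto_mul_laplace_of_convergesTo_zero {T : ℝ} (hT : 0 < T) {f : ℝ → ℝ}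
    (hloc : ∀ t₀ : ℝ, 0 ≤ t₀ → MemLp f 2 (horizon t₀))
    (hc : ConvergesTo f fun _ => 0) (ν : ℝ) :
    Tendsto (fun σ : ℝ => ((1 - Real.exp (-σ * T) : ℝ) : ℂ) * laplace f (σ + ν * Complex.I))
      (nhdsWithin 0 (Set.Ioi 0)) (nhds 0) := by
  rw [Metric.tendsto_nhdsWithin_nhds]
  intro ε hε
  obtain ⟨t₀, ht₀, h⟩ := hc (ε / (2 * T)) (by positivity)
  set C := ∫ t, (Set.Iic t₀).indicator (fun t => |f t|) t ∂timeAxis with hC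
  have hC0 : 0 ≤ C := integral_nonneg fun t => Set.indicator_nonneg (fun _ _ => abs_nonneg _) t
  refine ⟨ε / (2 * (T * (C + 1))), by positivity, fun {σ} hσ hd => ?_⟩
  have hσ : 0 < σ := hσ
  rw [dist_zero_right, Real.norm_of_nonneg hσ.le, lt_div_iff₀ (by positivity)] at hd
  rw [dist_zero_right, norm_mul, Complex.norm_real]
  have hind : Integrable ((Set.Iic t₀).indicator fun t => |f t|) timeAxis := by
    rw [integrable_indicator_iff measurableSet_Iic, IntegrableOn, timeAxis,
      Measure.restrict_restrict measurableSet_Iic, Set.inter_comm, Set.Ici_inter_Iic]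
    have : IsFiniteMeasure (horizon t₀) := by unfold horizon; infer_instance
    exact ((hloc t₀ ht₀.le).integrable (by norm_num)).abs
  have hexpint : Integrable (fun t : ℝ => Real.exp (-σ * t)) timeAxis :=
    (integrableOn_Ici_iff_integrableOn_Ioi).2 (exp_neg_integrableOn_Ioi 0 hσ)
  have hexp : ∫ t, Real.exp (-σ * t) ∂timeAxis = 1 / σ := by
    rw [integral_timeAxis_eq, integral_exp_mul_Ioi (by linarith)]
    simp
  have hlap : ‖laplace f (σ + ν * Complex.I)‖ ≤ C + ε / (2 * T) * (1 / σ) := by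
    rw [← hexp, ← integral_const_mul, hC, ← integral_add hind (hexpint.const_mul _)]
    refine norm_integral_le_of_norm_le (hind.add (hexpint.const_mul _)) ?_
    filter_upwards [h, ae_timeAxis_nonneg] with t ht h0
    rw [norm_exp_neg_mul, norm_mul, Real.norm_eq_abs (Real.exp _), Real.abs_exp]
    have hre : ((σ : ℂ) + ν * Complex.I).re = σ := by simp
    rw [hre]
    rcases le_or_gt t t₀ with htt | htt
    · simp only [Set.indicator_of_mem (show t ∈ Set.Iic t₀ from htt)]
      have h1 : Real.exp (-σ * t) ≤ 1 := Real.exp_le_one_iff.2 (by nlinarith)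
      have h2 : Real.exp (-σ * t) * ‖f t‖ ≤ |f t| := mul_le_of_le_one_left (abs_nonneg _) h1
      have h3 : 0 ≤ ε / (2 * T) * Real.exp (-σ * t) := by positivity
      linarith
    · simp only [Set.indicator_of_notMem (show t ∉ Set.Iic t₀ from not_le.2 htt), zero_add]
      have h1 := ht htt.le
      rw [sub_zero] at h1
      rw [mul_comm]
      exact mul_le_mul_of_nonneg_right h1.le (Real.exp_pos _).le
  have h1 : 1 - Real.exp (-σ * T) ≤ σ * T := by
    have := Real.add_one_le_exp (-σ * T)
    linarith
  have h2 : 0 ≤ 1 - Real.exp (-σ * T) := by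
    have : Real.exp (-σ * T) ≤ 1 := Real.exp_le_one_iff.2 (by nlinarith)
    linarith
  rw [Real.norm_of_nonneg h2]
  calc (1 - Real.exp (-σ * T)) * ‖laplace f (σ + ν * Complex.I)‖
      ≤ σ * T * (C + ε / (2 * T) * (1 / σ)) := by gcongr
    _ = σ * T * C + ε / 2 := by field_simp
    _ < ε := by nlinarith [mul_pos hσ hT]

theorem tendsto_integral_exp_mul {T : ℝ} (hT : 0 < T) {f : ℝ → ℝ}
    (hf : IntervalIntegrable f volume 0 T) (ν : ℝ) :
    Tendsto (fun σ : ℝ => ∫ t in (0 : ℝ)..T, Complex.exp (-(σ + ν * Complex.I) * t) * (f t : ℂ))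
      (nhdsWithin 0 (Set.Ioi 0))
      (nhds (∫ t in (0 : ℝ)..T, Complex.exp (-(ν * Complex.I) * t) * (f t : ℂ))) := by
  refine intervalIntegral.tendsto_integral_filter_of_dominated_convergence (fun t => |f t|)
    ?_ ?_ hf.abs ?_
  · refine Eventually.of_forall fun σ => ?_
    exact (Continuous.aestronglyMeasurable (by fun_prop)).mul
      (Complex.continuous_ofReal.comp_aestronglyMeasurable hf.def'.aestronglyMeasurable)
  · filter_upwards [self_mem_nhdsWithin] with σ hσ
    refine ae_of_all _ fun t ht => ?_
    rw [Set.uIoc_of_le hT.le] at ht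
    have hσ : 0 < σ := hσ
    rw [norm_exp_neg_mul, norm_mul, Real.norm_eq_abs (Real.exp _), Real.abs_exp]
    refine mul_le_of_le_one_left (abs_nonneg _) (Real.exp_le_one_iff.2 ?_)
    simp only [Complex.add_re, Complex.ofReal_re, Complex.mul_re, Complex.I_re, mul_zero,
      Complex.ofReal_im, Complex.I_im, mul_one, sub_self, add_zero]
    nlinarith [ht.1]
  · refine ae_of_all _ fun t _ => tendsto_nhdsWithin_of_tendsto_nhds ?_
    have hc : Continuous fun σ : ℝ => Complex.exp (-(σ + ν * Complex.I) * t) * (f t : ℂ) := by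
      fun_prop
    simpa using hc.tendsto 0

theorem IsL2e.intervalIntegrable {f : ℝ → ℝ} (hf : IsL2e f) {a b : ℝ} (ha : 0 ≤ a)
    (hab : a ≤ b) : IntervalIntegrable f volume a b := by
  rw [intervalIntegrable_iff_integrableOn_Icc_of_le hab]
  have : IsFiniteMeasure (horizon b) := by unfold horizon; infer_instance
  have h : IntegrableOn f (Set.Icc 0 b) := (hf b (ha.trans hab)).integrable (by norm_num)
  exact h.mono_set (Set.Icc_subset_Icc_left ha)

/-- At a harmonic `ν` the factor `1 - e^{-sT}` reduces to the real number `1 - e^{-σT}`, so the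
periodic part gives its one-period integral exactly and the transient is killed in the limit. -/
theorem tendsto_laplace_of_steadyState {T : ℝ} (hT : 0 < T) {y y' : ℝ → ℝ} (hy : IsL2e y)
    (h : IsSteadyState T y y') {ν : ℝ} (hν : Complex.exp (-(ν * Complex.I) * T) = 1) :
    Tendsto (fun σ : ℝ => ((1 - Real.exp (-σ * T) : ℝ) : ℂ) * laplace y (σ + ν * Complex.I))
      (nhdsWithin 0 (Set.Ioi 0))
      (nhds (∫ t in (0 : ℝ)..T, Complex.exp (-(ν * Complex.I) * t) * (y' t : ℂ))) := by
  obtain ⟨hy', hhw, hc⟩ := h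
  have hper := hhw.periodic hT
  have hye := hy'.isExpL2_of_periodic hT hper
  have hyE := isExpL2_of_convergesTo hy hy' hye hc
  have hd := tendsto_mul_laplace_of_convergesTo_zero hT (f := fun t => y t - y' t)
    (fun t₀ ht₀ => (hy t₀ ht₀).sub (hy' t₀ ht₀)) (by simpa [ConvergesTo] using hc) ν
  have hp := tendsto_integral_exp_mul hT (hy'.intervalIntegrable le_rfl hT.le) ν
  have hsum := hp.add hd
  rw [add_zero] at hsum
  refine hsum.congr' ?_
  filter_upwards [self_mem_nhdsWithin] with σ hσ
  have hre : 0 < ((σ : ℂ) + ν * Complex.I).re := by simpa using hσ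
  rw [laplace_sub hyE hye hre, ← laplace_of_periodic hT hye hper hre]
  have he : Complex.exp (-(σ + ν * Complex.I) * T) = ((Real.exp (-σ * T) : ℝ) : ℂ) := by
    rw [neg_add, add_mul, Complex.exp_add, hν]
    push_cast
    ring
  rw [he]
  push_cast
  ring

theorem integral_steadyState_output {G : ℂ → ℂ} (hG : IsProperStable G) {T : ℝ} (hT : 0 < T)
    {e y e' y' : ℝ → ℝ} (hout : IsOutput G e y) (he : IsSteadyState T e e')
    (hy : IsSteadyState T y y') {ν : ℝ} (hν : Complex.exp (-(ν * Complex.I) * T) = 1) :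
    ∫ t in (0 : ℝ)..T, Complex.exp (-(ν * Complex.I) * t) * (y' t : ℂ) =
      G (ν * Complex.I) * ∫ t in (0 : ℝ)..T, Complex.exp (-(ν * Complex.I) * t) * (e' t : ℂ) := by
  obtain ⟨M, hM⟩ := hG.exists_bound
  have heE := isExpL2_of_convergesTo hout.1 he.1
    (he.1.isExpL2_of_periodic hT (he.2.1.periodic hT)) he.2.2
  have hyE := isExpL2_of_convergesTo hout.2.1 hy.1
    (hy.1.isExpL2_of_periodic hT (hy.2.1.periodic hT)) hy.2.2
  have h1 := tendsto_laplace_of_steadyState hT hout.1 he hν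
  have h2 := tendsto_laplace_of_steadyState hT hout.2.1 hy hν
  have hGc : Tendsto (fun σ : ℝ => G (σ + ν * Complex.I)) (nhdsWithin 0 (Set.Ioi 0))
      (nhds (G (ν * Complex.I))) := by
    have hca := (hG.stable (ν * Complex.I) (by simp)).continuousAt
    have hc : Continuous fun σ : ℝ => (σ : ℂ) + ν * Complex.I := by fun_prop
    have h0 := hc.tendsto 0
    simp only [Complex.ofReal_zero, zero_add] at h0
    exact tendsto_nhdsWithin_of_tendsto_nhds (hca.tendsto.comp h0)
  refine tendsto_nhds_unique h2 ((hGc.mul h1).congr' ?_)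
  filter_upwards [self_mem_nhdsWithin] with σ hσ
  rw [laplace_eq_of_isOutput hM hout heE hyE (by simpa using hσ)]
  ring

/-! ### Fourier coefficients, shifts and half-wave symmetry -/

theorem fourierCoeffOn_eq {T : ℝ} (hT : 0 < T) (f : ℝ → ℝ) (k : ℤ) :
    fourierCoeffOn hT (fun t => (f t : ℂ)) k =
      (1 / T : ℂ) * ∫ t in (0 : ℝ)..T,
        Complex.exp (-((k * (2 * Real.pi / T) : ℝ) * Complex.I) * t) * (f t : ℂ) := by
  rw [fourierCoeffOn_eq_integral, sub_zero, Complex.real_smul]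
  congr 1
  · push_cast
    rfl
  · refine intervalIntegral.integral_congr fun t _ => ?_
    simp only [smul_eq_mul]
    congr 1
    rw [fourier_coe_apply]
    congr 1
    push_cast
    ring

theorem fourierCoeffOn_steadyState_output {G : ℂ → ℂ} (hG : IsProperStable G) {T : ℝ}
    (hT : 0 < T) {e y e' y' : ℝ → ℝ} (hout : IsOutput G e y) (he : IsSteadyState T e e')
    (hy : IsSteadyState T y y') (k : ℤ) :
    fourierCoeffOn hT (fun t => (y' t : ℂ)) k =
      G (Complex.I * k * ((2 * Real.pi / T : ℝ) : ℂ)) *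
        fourierCoeffOn hT (fun t => (e' t : ℂ)) k := by
  rw [fourierCoeffOn_eq, fourierCoeffOn_eq, integral_steadyState_output hG hT hout he hy]
  · rw [show ((k * (2 * Real.pi / T) : ℝ) : ℂ) * Complex.I =
      Complex.I * k * ((2 * Real.pi / T : ℝ) : ℂ) by push_cast; ring]
    ring
  · rw [Complex.exp_eq_one_iff]
    refine ⟨-k, ?_⟩
    have : (T : ℂ) ≠ 0 := by exact_mod_cast hT.ne'
    push_cast
    field_simp

theorem horizon_eq_restrict_Ioc (T : ℝ) : horizon T = volume.restrict (Set.Ioc 0 T) :=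
  (Measure.restrict_congr_set Ioc_ae_eq_Icc).symm

theorem fourierCoeffOn_congr_horizon {T : ℝ} (hT : 0 < T) {f g : ℝ → ℝ}
    (h : f =ᵐ[horizon T] g) :
    fourierCoeffOn hT (fun t => (f t : ℂ)) = fourierCoeffOn hT (fun t => (g t : ℂ)) := by
  refine fourierCoeffOn_congr_ae hT ?_
  rw [← horizon_eq_restrict_Ioc]
  filter_upwards [h] with t ht
  rw [ht]

theorem ae_eq_zero_of_fourierCoeffOn_eq_zero {T : ℝ} (hT : 0 < T) {f : ℝ → ℝ}
    (hf : MemLp f 2 (horizon T)) (h : ∀ k : ℤ, fourierCoeffOn hT (fun t => (f t : ℂ)) k = 0) :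
    ∀ᵐ t ∂horizon T, f t = 0 := by
  have hfC : MemLp (fun t => (f t : ℂ)) 2 (volume.restrict (Set.Ioc 0 T)) := by
    rw [← horizon_eq_restrict_Ioc]
    exact hf.ofReal
  have h1 := hasSum_sq_fourierCoeffOn hT hfC
  simp only [h, norm_zero, ne_eq, OfNat.ofNat_ne_zero, not_false_eq_true, zero_pow, sub_zero,
    Complex.norm_real, Real.norm_eq_abs, sq_abs, smul_eq_mul] at h1
  have h2 := h1.unique hasSum_zero
  rw [mul_eq_zero, or_iff_right (inv_ne_zero hT.ne'), intervalIntegral.integral_of_le hT.le,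
    ← horizon_eq_restrict_Ioc, integral_eq_zero_iff_of_nonneg (fun t => sq_nonneg _)
      hf.integrable_sq] at h2
  filter_upwards [h2] with t ht
  exact pow_eq_zero_iff (two_ne_zero) |>.1 ht

theorem ae_timeAxis_of_periodic_of_horizon {T : ℝ} (hT : 0 < T) {P : ℝ → Prop}
    (hper : ∀ᵐ t ∂timeAxis, P t → P (t + T)) (h : ∀ᵐ t ∂horizon T, P t) :
    ∀ᵐ t ∂timeAxis, P t := by
  have h0 := ae_timeAxis_of_horizon h
  rw [ae_timeAxis_iff] at hper h0 ⊢
  have key : ∀ n : ℕ, ∀ᵐ t : ℝ, 0 ≤ t → t ≤ n * T → P t := by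
    intro n
    induction n with
    | zero =>
      filter_upwards [h0] with t h1 h2 h3
      push_cast at h3
      exact h1 h2 (by linarith)
    | succ n ih =>
      filter_upwards [h0, ae_comp_add_right ih (-T), ae_comp_add_right hper (-T)]
        with t h1 h2 h3 h4 h5
      push_cast at h5
      rcases le_or_gt t T with h6 | h6
      · exact h1 h4 h6
      · have h7 := h3 (by linarith) (h2 (by linarith) (by linarith))
        simpa using h7
  filter_upwards [ae_all_iff.2 key] with t ht h1
  obtain ⟨n, hn⟩ := exists_nat_ge (t / T)
  exact ht n h1 ((div_le_iff₀ hT).1 hn)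

theorem memLp_shift_horizon {f : ℝ → ℝ} {a R : ℝ}
    (hf : MemLp f 2 (volume.restrict (Set.Icc a (a + R)))) : MemLp (fun t => f (t + a)) 2 (horizon R) := by
  have h := ((measurePreserving_add_right volume a).restrict_preimage
    (measurableSet_Icc (a := a) (b := a + R)))
  rw [Set.preimage_add_const_Icc, sub_self, add_sub_cancel_left] at h
  exact hf.comp_measurePreserving h

theorem IsL2e.shift {f : ℝ → ℝ} (hf : IsL2e f) {h : ℝ} (hh : 0 ≤ h) :
    IsL2e fun t => f (t + h) := by
  intro R hR
  refine memLp_shift_horizon ((hf (h + R) (by positivity)).mono_measure ?_)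
  exact Measure.restrict_mono (Set.Icc_subset_Icc_left hh) le_rfl

theorem IsL2e.sub {f g : ℝ → ℝ} (hf : IsL2e f) (hg : IsL2e g) : IsL2e fun t => f t - g t :=
  fun R hR => (hf R hR).sub (hg R hR)

theorem isL2e_of_periodic {T : ℝ} (hT : 0 < T) {f : ℝ → ℝ}
    (hper : ∀ᵐ t ∂timeAxis, f (t + T) = f t) (hf : MemLp f 2 (horizon T)) : IsL2e f := by
  have key : ∀ n : ℕ, MemLp f 2 (horizon (n * T)) := by
    intro n
    induction n with
    | zero =>
      have h0 : horizon ((0 : ℕ) * T) = 0 := by simp [horizon]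
      rw [h0]
      exact memLp_measure_zero
    | succ n ih =>
      have h1 : MemLp f 2 (volume.restrict (Set.Icc T (T + n * T))) := by
        have h2 := (measurePreserving_add_right volume (-T)).restrict_preimage
          (measurableSet_Icc (a := (0 : ℝ)) (b := n * T))
        rw [Set.preimage_add_const_Icc, sub_neg_eq_add, sub_neg_eq_add, zero_add,
          add_comm _ T] at h2
        refine (ih.comp_measurePreserving h2).ae_eq ?_
        rw [ae_timeAxis_iff] at hper
        have h3 := ae_restrict_of_ae (s := Set.Icc T (T + n * T)) (ae_comp_add_right hper (-T))
        filter_upwards [h3, ae_restrict_mem measurableSet_Icc] with t h4 h5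
        have h6 := h4 (by linarith [h5.1])
        simpa using h6.symm
      have h4 : Set.Icc 0 (((n + 1 : ℕ) : ℝ) * T) = Set.Icc 0 T ∪ Set.Icc T (T + n * T) := by
        rw [Set.Icc_union_Icc_eq_Icc hT.le (by simp; positivity)]
        push_cast
        ring_nf
      unfold horizon
      rw [h4]
      rw [memLp_two_iff_integrable_sq (aestronglyMeasurable_union_iff.2
        ⟨hf.aestronglyMeasurable, h1.aestronglyMeasurable⟩)]
      exact IntegrableOn.union hf.integrable_sq h1.integrable_sq
  intro R hR
  obtain ⟨n, hn⟩ := exists_nat_ge (R / T)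
  exact (key n).mono_measure
    (Measure.restrict_mono (Set.Icc_subset_Icc_right ((div_le_iff₀ hT).1 hn)) le_rfl)

/-- A representative periodic on all of `ℝ` lets the integration window `[h, h + T]` be moved back
to `[0, T]`. -/
theorem fourierCoeffOn_shift {T : ℝ} (hT : 0 < T) {f : ℝ → ℝ}
    (hper : ∀ᵐ t ∂timeAxis, f (t + T) = f t) {h : ℝ} (hh : 0 ≤ h) (k : ℤ) :
    fourierCoeffOn hT (fun t => (f (t + h) : ℂ)) k =
      Complex.exp (((k * (2 * Real.pi / T) : ℝ) * Complex.I) * h) *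
        fourierCoeffOn hT (fun t => (f t : ℂ)) k := by
  obtain ⟨p, hp, hpf⟩ := exists_periodic_ae_eq hT hper
  rw [fourierCoeffOn_congr_horizon hT (f := f) (g := p)
      (by filter_upwards [ae_horizon_of_timeAxis hpf T] with t ht using ht.symm),
    fourierCoeffOn_congr_horizon hT (f := fun t => f (t + h)) (g := fun t => p (t + h))
      (by filter_upwards [ae_horizon_of_timeAxis (ae_timeAxis_shift hpf hh) T] with t ht
          using ht.symm)]
  rw [fourierCoeffOn_eq hT fun t => p (t + h), fourierCoeffOn_eq]
  set ν : ℂ := ((k * (2 * Real.pi / T) : ℝ) : ℂ) * Complex.I with hν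
  set q : ℝ → ℂ := fun t => Complex.exp (-ν * t) * (p t : ℂ) with hq
  have hqper : Function.Periodic q T := by
    intro t
    simp only [hq, hp t]
    congr 1
    rw [Complex.exp_eq_exp_iff_exists_int]
    refine ⟨-k, ?_⟩
    have : (T : ℂ) ≠ 0 := by exact_mod_cast hT.ne'
    rw [hν]
    push_cast
    field_simp
    ring
  have h1 : ∀ t : ℝ, Complex.exp (-ν * t) * (p (t + h) : ℂ) =
      Complex.exp (ν * h) * q (t + h) := by
    intro t
    simp only [hq]
    rw [← mul_assoc, ← Complex.exp_add]
    push_cast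
    ring_nf
  simp_rw [h1]
  rw [intervalIntegral.integral_const_mul, intervalIntegral.integral_comp_add_right q h, zero_add,
    add_comm T h, hqper.intervalIntegral_add_eq h 0, zero_add]
  ring

theorem fourierCoeffOn_neg' {T : ℝ} (hT : 0 < T) (f : ℝ → ℝ) (k : ℤ) :
    fourierCoeffOn hT (fun t => ((-f t : ℝ) : ℂ)) k =
      -fourierCoeffOn hT (fun t => (f t : ℂ)) k := by
  rw [fourierCoeffOn_eq hT fun t => -f t, fourierCoeffOn_eq, ← mul_neg (1 / T : ℂ),
    ← intervalIntegral.integral_neg]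
  simp

theorem fourierCoeffOn_add' {T : ℝ} (hT : 0 < T) {f g : ℝ → ℝ} (hf : MemLp f 2 (horizon T))
    (hg : MemLp g 2 (horizon T)) (k : ℤ) :
    fourierCoeffOn hT (fun t => ((f t + g t : ℝ) : ℂ)) k =
      fourierCoeffOn hT (fun t => (f t : ℂ)) k + fourierCoeffOn hT (fun t => (g t : ℂ)) k := by
  have hi : ∀ {f : ℝ → ℝ}, MemLp f 2 (horizon T) → IntervalIntegrable (fun t : ℝ => Complex.exp
      (-((k * (2 * Real.pi / T) : ℝ) * Complex.I) * t) * (f t : ℂ)) volume 0 T := by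
    intro f hf
    have : IsFiniteMeasure (horizon T) := by unfold horizon; infer_instance
    have h1 : IntervalIntegrable (fun t => (f t : ℂ)) volume 0 T := by
      rw [intervalIntegrable_iff_integrableOn_Icc_of_le hT.le]
      exact (hf.integrable (by norm_num)).ofReal
    exact h1.continuousOn_mul (by fun_prop)
  rw [fourierCoeffOn_eq hT fun t => f t + g t, fourierCoeffOn_eq, fourierCoeffOn_eq, ← mul_add,
    ← intervalIntegral.integral_add (hi hf) (hi hg)]
  congr 2
  ext t
  push_cast
  ring

theorem fourierCoeffOn_sub' {T : ℝ} (hT : 0 < T) {f g : ℝ → ℝ} (hf : MemLp f 2 (horizon T))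
    (hg : MemLp g 2 (horizon T)) (k : ℤ) :
    fourierCoeffOn hT (fun t => ((f t - g t : ℝ) : ℂ)) k =
      fourierCoeffOn hT (fun t => (f t : ℂ)) k - fourierCoeffOn hT (fun t => (g t : ℂ)) k := by
  have h := fourierCoeffOn_add' hT hf hg.neg k
  simp only [Pi.neg_apply] at h
  rw [fourierCoeffOn_neg' hT] at h
  simpa [sub_eq_add_neg] using h

theorem exp_half_period {T : ℝ} (hT : 0 < T) (k : ℤ) :
    Complex.exp (((k * (2 * Real.pi / T) : ℝ) * Complex.I) * ((T / 2 : ℝ) : ℂ)) = (-1) ^ k := by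
  rw [← Complex.exp_pi_mul_I, ← Complex.exp_int_mul]
  congr 1
  have : (T : ℂ) ≠ 0 := by exact_mod_cast hT.ne'
  push_cast
  field_simp

/-- A shift by `T/2` multiplies the `k`-th coefficient by `(-1)^k = 1`, and the symmetry multiplies
it by `-1`. -/
theorem IsHalfWavePeriodic.fourierCoeffOn_even {T : ℝ} (hT : 0 < T) {f : ℝ → ℝ}
    (hf : IsHalfWavePeriodic T f) {k : ℤ} (hk : Even k) :
    fourierCoeffOn hT (fun t => (f t : ℂ)) k = 0 := by
  have h1 := fourierCoeffOn_shift hT (hf.periodic hT) (half_pos hT).le k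
  rw [exp_half_period hT, hk.neg_one_zpow, one_mul, fourierCoeffOn_congr_horizon hT
    (f := fun t => f (t + T / 2)) (g := fun t => -f t) (ae_horizon_of_timeAxis hf T),
    fourierCoeffOn_neg'] at h1
  exact self_eq_neg.1 h1.symm

theorem IsOddHarmonicSignal.isL2e {T : ℝ} {hT : 0 < T} {u : ℝ → ℝ}
    (hu : IsOddHarmonicSignal hT u) : IsL2e u := by
  obtain ⟨⟨f, -, hf⟩, hper⟩ := hu
  exact isL2e_of_periodic hT hper ((Lp.memLp f).ae_eq hf.symm)

/-- The coefficients of `u(t + T/2) + u(t)` are `(1 + (-1)^k)` times those of `u`: the factor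
vanishes for odd `k`, the coefficient of `u` for even `k`. -/
theorem IsOddHarmonicSignal.isHalfWavePeriodic {T : ℝ} {hT : 0 < T} {u : ℝ → ℝ}
    (hu : IsOddHarmonicSignal hT u) : IsHalfWavePeriodic T u := by
  have hL := hu.isL2e
  obtain ⟨⟨f, hfo, hf⟩, hper⟩ := hu
  have hh := (half_pos hT).le
  have h0 : ∀ᵐ t ∂horizon T, u (t + T / 2) + u t = 0 := by
    refine ae_eq_zero_of_fourierCoeffOn_eq_zero hT
      (((hL.shift hh) T hT.le).add (hL T hT.le)) fun k => ?_
    rw [fourierCoeffOn_add' hT ((hL.shift hh) T hT.le) (hL T hT.le),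
      fourierCoeffOn_shift hT hper hh,
      exp_half_period hT]
    rcases Int.even_or_odd k with hk | hk
    · rw [fourierCoeffOn_congr_horizon hT hf, hfo k hk]
      simp
    · rw [hk.neg_one_zpow]
      ring
  have h1 : ∀ᵐ t ∂timeAxis, u (t + T / 2) + u t = 0 := by
    refine ae_timeAxis_of_periodic_of_horizon hT ?_ h0
    filter_upwards [hper, ae_timeAxis_shift hper hh] with t h1 h2 h3
    rw [h1, show t + T + T / 2 = t + T / 2 + T by ring, h2, h3]
  filter_upwards [h1] with t ht
  linarith

/-! ### Geometry of the inverse scaled graph -/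

section Geometry

variable {H : Type*} [NormedAddCommGroup H] [InnerProductSpace ℝ H]

/-- The inverse point has modulus `‖e‖ / ‖y‖` and argument minus the angle, so this is the law of
cosines in the plane spanned by `e` and `y`. -/
theorem norm_inv_scaledGraph_point_add {e y : H} (he : e ≠ 0) (hy : y ≠ 0) (m : ℝ) :
    ‖(((‖y‖ / ‖e‖ : ℝ) : ℂ) *
        Complex.exp (Complex.I * (InnerProductGeometry.angle e y : ℂ)))⁻¹ + m‖ * ‖y‖ =
      ‖e + m • y‖ := by
  have hy0 : ‖y‖ ≠ 0 := norm_ne_zero_iff.2 hy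
  have he0 : ‖e‖ ≠ 0 := norm_ne_zero_iff.2 he
  set θ := InnerProductGeometry.angle e y with hθ
  have hcos : Real.cos θ * (‖e‖ * ‖y‖) = inner ℝ e y :=
    InnerProductGeometry.cos_angle_mul_norm_mul_norm e y
  have hw : (((‖y‖ / ‖e‖ : ℝ) : ℂ) * Complex.exp (Complex.I * (θ : ℂ)))⁻¹ + m =
      ((‖e‖ / ‖y‖ * Real.cos θ + m : ℝ) : ℂ) +
        ((-(‖e‖ / ‖y‖ * Real.sin θ) : ℝ) : ℂ) * Complex.I := by
    rw [mul_inv, ← Complex.exp_neg, show -(Complex.I * (θ : ℂ)) = ((-θ : ℝ) : ℂ) * Complex.I by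
      push_cast; ring, Complex.exp_mul_I, ← Complex.ofReal_cos, ← Complex.ofReal_sin, Real.cos_neg,
      Real.sin_neg, ← Complex.ofReal_inv, inv_div]
    push_cast
    ring
  rw [← sq_eq_sq₀ (by positivity) (norm_nonneg _), mul_pow, hw, ← Complex.normSq_eq_norm_sq,
    Complex.normSq_add_mul_I, norm_add_sq_real, inner_smul_right, norm_smul, mul_pow, ← hcos,
    Real.norm_eq_abs, sq_abs]
  have hsc := Real.sin_sq_add_cos_sq θ
  field_simp
  linear_combination (‖e‖ ^ 2) * hsc

/-- Separation of the inverse scaled graph from a disk bounds `‖e + m y‖` from below. -/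
theorem le_norm_add_of_le_setDist {U : Set H} {R : Set (H × H)} {e y : H} (heU : e ∈ U)
    (hR : (e, y) ∈ R) (he : e ≠ 0) (hy : y ≠ 0) {α β : ℝ} (hαβ : α ≤ β) {r : ℝ≥0∞} (hr : 0 < r)
    (h : r ≤ setDist (invSet (scaledGraph U R)) ((fun z : ℂ => (z : OnePoint ℂ)) '' (-disk α β))) :
    r ≠ ⊤ ∧ ((β - α) / 2 + r.toReal) * ‖y‖ ≤ ‖e + ((α + β) / 2) • y‖ := by
  have hy0 : 0 < ‖y‖ := norm_pos_iff.2 hy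
  have he0 : 0 < ‖e‖ := norm_pos_iff.2 he
  set z : ℂ := ((‖y‖ / ‖e‖ : ℝ) : ℂ) *
    Complex.exp (Complex.I * (InnerProductGeometry.angle e y : ℂ)) with hz
  have hz0 : z ≠ 0 := mul_ne_zero (by exact_mod_cast (div_pos hy0 he0).ne') (Complex.exp_ne_zero _)
  have hmem : ((z⁻¹ : ℂ) : OnePoint ℂ) ∈ invSet (scaledGraph U R) :=
    ⟨z, ⟨e, heU, he, y, hR, Or.inl rfl⟩, Or.inr ⟨hz0, rfl⟩⟩
  have hdist : ∀ p ∈ -disk α β, r ≤ edist z⁻¹ p := fun p hp =>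
    h.trans ((iInf₂_le _ hmem).trans (iInf₂_le (p : OnePoint ℂ) ⟨p, hp, rfl⟩))
  set m : ℝ := (α + β) / 2 with hm
  set ρ : ℝ := (β - α) / 2 with hρ
  have hρ0 : 0 ≤ ρ := by rw [hρ]; linarith
  have hdisk : ∀ p : ℂ, p ∈ -disk α β ↔ ‖p + m‖ ≤ ρ := by
    intro p
    rw [Set.mem_neg, disk, mem_closedBall_iff_norm, ← hm, ← hρ, ← norm_neg, neg_sub,
      sub_neg_eq_add, add_comm]
  have hr_top : r ≠ ⊤ := ne_top_of_le_ne_top (edist_ne_top _ _)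
    (hdist (-m) ((hdisk _).2 (by simpa using hρ0)))
  refine ⟨hr_top, ?_⟩
  rw [← norm_inv_scaledGraph_point_add he hy m]
  refine mul_le_mul_of_nonneg_right ?_ hy0.le
  rw [← hz]
  set d := ‖z⁻¹ + m‖ with hd
  have hdr : ∀ p ∈ -disk α β, r.toReal ≤ ‖z⁻¹ - p‖ := by
    intro p hp
    have h1 := hdist p hp
    rw [edist_eq_enorm_sub] at h1
    simpa using ENNReal.toReal_mono (by simp) h1
  have hrpos : 0 < r.toReal := ENNReal.toReal_pos hr.ne' hr_top
  have hlt : ρ < d := by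
    by_contra hle
    have h1 := hdr z⁻¹ ((hdisk _).2 (not_lt.1 hle))
    rw [sub_self, norm_zero] at h1
    linarith
  have hd0 : 0 < d := hρ0.trans_lt hlt
  -- The point of the reflected disk nearest to `z⁻¹`, which lies outside: its radial projection, at
  -- distance `d - ρ`.
  have h1 := hdr (-m + (ρ / d : ℝ) * (z⁻¹ + m)) (by
    rw [hdisk, show -(m : ℂ) + (ρ / d : ℝ) * (z⁻¹ + m) + m = (ρ / d : ℝ) * (z⁻¹ + m) by ring,
      norm_mul, ← hd, Complex.norm_real, Real.norm_of_nonneg (by positivity),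
      div_mul_cancel₀ _ hd0.ne'])
  rw [show z⁻¹ - (-(m : ℂ) + (ρ / d : ℝ) * (z⁻¹ + m)) = ((1 - ρ / d : ℝ) : ℂ) * (z⁻¹ + m) by
    push_cast; ring, norm_mul, ← hd, Complex.norm_real, Real.norm_of_nonneg (by
      rw [sub_nonneg, div_le_one hd0]; exact hlt.le), sub_mul, div_mul_cancel₀ _ hd0.ne'] at h1
  linarith

end Geometry

/-! ### The gain inequality -/

theorem toLp_mem_oddHarmonics {T : ℝ} (hT : 0 < T) {f : ℝ → ℝ} (hf : MemLp f 2 (horizon T))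
    (h : ∀ k : ℤ, Even k → fourierCoeffOn hT (fun t => (f t : ℂ)) k = 0) :
    hf.toLp ∈ oddHarmonics hT := by
  intro k hk
  rw [fourierCoeffOn_congr_horizon hT hf.coeFn_toLp]
  exact h k hk

/-- The gain inequality for the feedback interconnection of the steady-state map of
`G` with a sector-bounded nonlinearity output `w`. -/
theorem normT_le_of_le_margin {T : ℝ} (hT : 0 < T) {G : ℂ → ℂ} {e y w u : ℝ → ℝ}
    (he : MemLp e 2 (horizon T)) (hy : MemLp y 2 (horizon T))
    (he_odd : ∀ k : ℤ, Even k → fourierCoeffOn hT (fun t => (e t : ℂ)) k = 0)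
    (hy_odd : ∀ k : ℤ, Even k → fourierCoeffOn hT (fun t => (y t : ℂ)) k = 0)
    (hG : ∀ k : ℤ, fourierCoeffOn hT (fun t => (y t : ℂ)) k =
      G (Complex.I * k * ((2 * Real.pi / T : ℝ) : ℂ)) *
        fourierCoeffOn hT (fun t => (e t : ℂ)) k)
    (hw : AEStronglyMeasurable w (horizon T)) {α β : ℝ} (hαβ : α ≤ β)
    (hsec : ∀ᵐ t ∂horizon T, |w t - (α + β) / 2 * y t| ≤ (β - α) / 2 * |y t|)
    (hu : ∀ᵐ t ∂horizon T, u t = e t + w t) {r : ℝ≥0∞} (hr : 0 < r)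
    (hmar : r ≤ margin hT G α β) :
    normT T y ≤ r⁻¹ * normT T u := by
  -- This case also covers `r = ⊤`: a nonzero `y` gives a finite point of the inverse scaled graph
  -- and so a finite margin.
  by_cases hy0 : hy.toLp = 0
  · have : normT T y = 0 := by
      rw [normT, ← Lp.enorm_toLp hy, hy0, enorm_zero]
    rw [this]
    exact zero_le
  have he0 : he.toLp ≠ 0 := by
    intro h0
    refine hy0 ((Lp.eq_zero_iff_ae_eq_zero).2 ?_)
    have hez : e =ᵐ[horizon T] fun _ => 0 := by
      filter_upwards [he.coeFn_toLp, (Lp.eq_zero_iff_ae_eq_zero).1 h0] with t h1 h2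
      rw [← h1, h2]
      rfl
    have := ae_eq_zero_of_fourierCoeffOn_eq_zero hT hy fun k => by
      rw [hG, fourierCoeffOn_congr_horizon hT hez, fourierCoeffOn_eq]
      simp
    filter_upwards [hy.coeFn_toLp, this] with t h1 h2
    rw [h1, h2]
    rfl
  have hR : (he.toLp, hy.toLp) ∈ steadyStateMap hT G := by
    refine ⟨toLp_mem_oddHarmonics hT he he_odd, toLp_mem_oddHarmonics hT hy hy_odd, fun k => ?_⟩
    rw [fourierCoeffOn_congr_horizon hT hy.coeFn_toLp,
      fourierCoeffOn_congr_horizon hT he.coeFn_toLp]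
    exact hG k
  obtain ⟨hrt, hgeo⟩ := le_norm_add_of_le_setDist (toLp_mem_oddHarmonics hT he he_odd) hR he0 hy0
    hαβ hr hmar
  set m := (α + β) / 2 with hm
  set ρ := (β - α) / 2 with hρ
  have hρ0 : 0 ≤ ρ := by rw [hρ]; linarith
  have hwy : AEStronglyMeasurable (fun t => w t - m * y t) (horizon T) :=
    hw.sub (hy.aestronglyMeasurable.const_mul m)
  have hwym : MemLp (fun t => w t - m * y t) 2 (horizon T) := by
    refine (hy.const_mul ρ).mono hwy ?_
    filter_upwards [hsec] with t ht
    rw [Real.norm_eq_abs, norm_mul, Real.norm_of_nonneg hρ0]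
    exact ht
  have hum : MemLp u 2 (horizon T) := by
    refine ((he.add hwym).add (hy.const_mul m)).ae_eq ?_
    filter_upwards [hu] with t ht
    simp only [Pi.add_apply]
    rw [ht]
    ring
  have hsplit : he.toLp + m • hy.toLp = hum.toLp - hwym.toLp := by
    rw [← MemLp.toLp_const_smul, ← MemLp.toLp_add, ← MemLp.toLp_sub, MemLp.toLp_eq_toLp_iff]
    filter_upwards [hu] with t ht
    simp only [Pi.add_apply, Pi.sub_apply, Pi.smul_apply, smul_eq_mul]
    rw [ht]
    ring
  have hwn : ‖hwym.toLp‖ ≤ ρ * ‖hy.toLp‖ := by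
    refine Lp.norm_le_mul_norm_of_ae_le_mul ?_
    filter_upwards [hwym.coeFn_toLp, hy.coeFn_toLp, hsec] with t h1 h2 h3
    rw [h1, h2]
    exact h3
  have hfin : r.toReal * ‖hy.toLp‖ ≤ ‖hum.toLp‖ := by
    have h1 := norm_sub_le hum.toLp hwym.toLp
    rw [← hsplit] at h1
    nlinarith
  have hE : r * normT T y ≤ normT T u := by
    unfold normT
    rw [← Lp.enorm_toLp hy, ← Lp.enorm_toLp hum, ← ofReal_norm, ← ofReal_norm,
      ← ENNReal.ofReal_toReal hrt, ← ENNReal.ofReal_mul ENNReal.toReal_nonneg]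
    exact ENNReal.ofReal_le_ofReal hfin
  calc normT T y = r⁻¹ * (r * normT T y) := by
        rw [← mul_assoc, ENNReal.inv_mul_cancel hr.ne' hrt, one_mul]
    _ ≤ r⁻¹ * normT T u := by gcongr

/-! ### The nonlinearity: centred sector and slope bounds -/

theorem abs_sub_mid_mul_le {p x c d : ℝ} (hx : x ≠ 0) (h : c ≤ p / x ∧ p / x ≤ d) :
    |p - (c + d) / 2 * x| ≤ (d - c) / 2 * |x| := by
  obtain ⟨q, rfl⟩ : ∃ q, p = q * x := ⟨p / x, (div_mul_cancel₀ p hx).symm⟩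
  rw [mul_div_cancel_right₀ _ hx] at h
  rw [← sub_mul, abs_mul]
  refine mul_le_mul_of_nonneg_right ?_ (abs_nonneg x)
  rw [abs_le]
  constructor <;> linarith [h.1, h.2]

theorem HasSlopeSectorBounds.slope_le {φ a b c d : ℝ → ℝ}
    (hφ : HasSlopeSectorBounds φ a b c d) {A : ℝ} (hA : 0 < A) : a A ≤ b A := by
  have h := hφ.slope A hA A 0 (abs_of_pos hA).le (by simpa using hA.le) hA.ne'
  exact h.1.trans h.2

theorem HasSlopeSectorBounds.sector_le {φ a b c d : ℝ → ℝ}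
    (hφ : HasSlopeSectorBounds φ a b c d) {A : ℝ} (hA : 0 < A) : c A ≤ d A := by
  have h := hφ.sector A hA A (abs_of_pos hA).le hA.ne'
  exact h.1.trans h.2

theorem HasSlopeSectorBounds.abs_slope_le {φ a b c d : ℝ → ℝ}
    (hφ : HasSlopeSectorBounds φ a b c d) {A : ℝ} (hA : 0 < A) {x y : ℝ} (hx : |x| ≤ A)
    (hy : |y| ≤ A) :
    |φ x - φ y - (a A + b A) / 2 * (x - y)| ≤ (b A - a A) / 2 * |x - y| := by
  rcases eq_or_ne x y with rfl | hxy
  · simp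
  · exact abs_sub_mid_mul_le (sub_ne_zero.2 hxy) (hφ.slope A hA x y hx hy hxy)

theorem HasSlopeSectorBounds.exists_lipschitz {φ a b c d : ℝ → ℝ}
    (hφ : HasSlopeSectorBounds φ a b c d) {A : ℝ} (hA : 0 < A) :
    ∃ K : ℝ, 0 ≤ K ∧ ∀ x y : ℝ, |x| ≤ A → |y| ≤ A → |φ x - φ y| ≤ K * |x - y| := by
  refine ⟨|(a A + b A) / 2| + (b A - a A) / 2, ?_, fun x y hx hy => ?_⟩
  · have := hφ.slope_le hA
    have := abs_nonneg ((a A + b A) / 2)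
    linarith
  · have h1 := hφ.abs_slope_le hA hx hy
    have h2 := abs_add_le (φ x - φ y - (a A + b A) / 2 * (x - y)) ((a A + b A) / 2 * (x - y))
    rw [sub_add_cancel, abs_mul] at h2
    linarith

theorem HasSlopeSectorBounds.continuous {φ a b c d : ℝ → ℝ}
    (hφ : HasSlopeSectorBounds φ a b c d) : Continuous φ := by
  rw [continuous_iff_continuousAt]
  intro x
  obtain ⟨K, -, hK⟩ := hφ.exists_lipschitz (A := |x| + 1) (by positivity)
  rw [ContinuousAt, tendsto_iff_norm_sub_tendsto_zero]
  have h0 : Tendsto (fun y => K * |y - x|) (nhds x) (nhds 0) := by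
    have hc : Continuous fun y => K * |y - x| := by fun_prop
    simpa using hc.tendsto x
  refine squeeze_zero' (Eventually.of_forall fun _ => norm_nonneg _) ?_ h0
  filter_upwards [Metric.ball_mem_nhds x one_pos] with y hy
  rw [Metric.mem_ball, Real.dist_eq] at hy
  refine hK y x ?_ (by linarith)
  have := abs_sub_abs_le_abs_sub y x
  linarith

/-- The sector bound says nothing at `0` itself, but forces `φ x → 0` as `x → 0`, `x ≠ 0`;
continuity, which comes from the slope bounds, does the rest. -/
theorem HasSlopeSectorBounds.map_zero {φ a b c d : ℝ → ℝ}
    (hφ : HasSlopeSectorBounds φ a b c d) : φ 0 = 0 := by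
  have h1 : Tendsto φ (nhdsWithin 0 {0}ᶜ) (nhds (φ 0)) :=
    tendsto_nhdsWithin_of_tendsto_nhds (hφ.continuous.tendsto 0)
  have h2 : Tendsto φ (nhdsWithin 0 {0}ᶜ) (nhds 0) := by
    rw [tendsto_zero_iff_norm_tendsto_zero]
    have h0 : Tendsto (fun y => (|(c 1 + d 1) / 2| + (d 1 - c 1) / 2) * |y|)
        (nhdsWithin 0 {0}ᶜ) (nhds 0) := by
      have hc : Continuous fun y => (|(c 1 + d 1) / 2| + (d 1 - c 1) / 2) * |y| := by fun_prop
      have := hc.tendsto 0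
      simp only [abs_zero, mul_zero] at this
      exact tendsto_nhdsWithin_of_tendsto_nhds this
    refine squeeze_zero' (Eventually.of_forall fun _ => norm_nonneg _) ?_ h0
    filter_upwards [self_mem_nhdsWithin, nhdsWithin_le_nhds (Metric.ball_mem_nhds 0 one_pos)]
      with y hy hy1
    rw [Metric.mem_ball, dist_zero_right, Real.norm_eq_abs] at hy1
    have h3 := abs_sub_mid_mul_le hy (hφ.sector 1 one_pos y hy1.le hy)
    have h4 := abs_add_le (φ y - (c 1 + d 1) / 2 * y) ((c 1 + d 1) / 2 * y)
    rw [sub_add_cancel, abs_mul ((c 1 + d 1) / 2)] at h4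
    rw [Real.norm_eq_abs]
    linarith
  exact tendsto_nhds_unique h1 h2

theorem HasSlopeSectorBounds.abs_sector_le {φ a b c d : ℝ → ℝ}
    (hφ : HasSlopeSectorBounds φ a b c d) {A : ℝ} (hA : 0 < A) {x : ℝ} (hx : |x| ≤ A) :
    |φ x - (c A + d A) / 2 * x| ≤ (d A - c A) / 2 * |x| := by
  rcases eq_or_ne x 0 with rfl | h0
  · simp [hφ.map_zero]
  · exact abs_sub_mid_mul_le h0 (hφ.sector A hA x hx h0)

/-! ### The loop in steady state -/

theorem ae_abs_le_of_normSup_le {f : ℝ → ℝ} {A : ℝ} (hA : 0 < A)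
    (h : normSup f ≤ ENNReal.ofReal A) : ∀ᵐ t ∂timeAxis, |f t| ≤ A := by
  unfold normSup at h
  rw [eLpNorm_exponent_top] at h
  filter_upwards [ae_le_eLpNormEssSup (f := f) (μ := timeAxis)] with t ht
  have h1 := ht.trans h
  rwa [← ofReal_norm, ENNReal.ofReal_le_ofReal_iff hA.le] at h1

/-- Eventually `|y'|` exceeds `A` by at most `1/(n+1)`; periodicity carries this back to all times,
and `n` is arbitrary. -/
theorem ae_abs_steadyState_le {T : ℝ} (hT : 0 < T) {y y' : ℝ → ℝ} (h : IsSteadyState T y y')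
    {A : ℝ} (hb : ∀ᵐ t ∂timeAxis, |y t| ≤ A) : ∀ᵐ t ∂timeAxis, |y' t| ≤ A := by
  have key : ∀ n : ℕ, ∀ᵐ t ∂timeAxis, |y' t| ≤ A + 1 / ((n : ℝ) + 1) := by
    intro n
    obtain ⟨t₀, -, ht₀⟩ := h.2.2 (1 / ((n : ℝ) + 1)) (by positivity)
    refine ae_timeAxis_of_periodic_of_eventually hT (t₀ := t₀) ?_ ?_
    · filter_upwards [h.2.1.periodic hT] with t h1 h2
      rwa [h1] at h2
    · filter_upwards [ht₀, hb] with t h1 h2 h3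
      have h4 := h1 h3
      have h5 := abs_sub_abs_le_abs_sub (y' t) (y t)
      rw [abs_sub_comm] at h5
      linarith
  filter_upwards [ae_all_iff.2 key] with t ht
  refine le_of_forall_pos_le_add fun ε hε => ?_
  obtain ⟨n, hn⟩ := exists_nat_one_div_lt hε
  linarith [ht n]

/-- The loop equation `e = u - φ(y)` persists in the periodic steady state. -/
theorem steadyState_loop_eq {φ a b c d : ℝ → ℝ} (hφ : HasSlopeSectorBounds φ a b c d) {T : ℝ}
    (hT : 0 < T) {u e y e' y' : ℝ → ℝ} (hu : ∀ᵐ t ∂timeAxis, u (t + T) = u t)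
    (hloop : ∀ᵐ t ∂timeAxis, e t = u t - φ (y t)) (he : IsSteadyState T e e')
    (hy : IsSteadyState T y y') {A : ℝ} (hA : 0 < A) (hb : ∀ᵐ t ∂timeAxis, |y' t| ≤ A) :
    ∀ᵐ t ∂timeAxis, u t = e' t + φ (y' t) := by
  -- Only `y'` is bounded by `A`; `y` is eventually within `1` of it, so the Lipschitz constant is
  -- taken on the larger range.
  obtain ⟨K, hK0, hK⟩ := hφ.exists_lipschitz (A := A + 1) (by positivity)
  have key : ∀ n : ℕ, ∀ᵐ t ∂timeAxis, |e' t - u t + φ (y' t)| ≤ (1 + K) / ((n : ℝ) + 1) := by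
    intro n
    have hn : 1 / ((n : ℝ) + 1) ≤ 1 := by
      rw [div_le_one (by positivity)]
      linarith [n.cast_nonneg (α := ℝ)]
    obtain ⟨t₁, -, ht₁⟩ := he.2.2 (1 / ((n : ℝ) + 1)) (by positivity)
    obtain ⟨t₂, -, ht₂⟩ := hy.2.2 (1 / ((n : ℝ) + 1)) (by positivity)
    refine ae_timeAxis_of_periodic_of_eventually hT (t₀ := max t₁ t₂) ?_ ?_
    · filter_upwards [hy.2.1.periodic hT, he.2.1.periodic hT, hu] with t h1 h2 h3 h4
      rwa [h1, h2, h3] at h4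
    · filter_upwards [ht₁, ht₂, hb, hloop] with t h1 h2 h3 h4 h5
      have h6 := h1 ((le_max_left _ _).trans h5)
      have h7 := h2 ((le_max_right _ _).trans h5)
      have h8 : |y t| ≤ A + 1 := by
        have := abs_sub_abs_le_abs_sub (y t) (y' t)
        linarith
      have h9 := hK (y' t) (y t) (by linarith) h8
      rw [abs_sub_comm] at h6 h7
      have h10 : K * |y' t - y t| ≤ K * (1 / ((n : ℝ) + 1)) :=
        mul_le_mul_of_nonneg_left h7.le hK0
      have h11 := abs_add_le (e' t - e t) (φ (y' t) - φ (y t))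
      rw [show e' t - u t + φ (y' t) = e' t - e t + (φ (y' t) - φ (y t)) by rw [h4]; ring]
      rw [add_div, div_eq_mul_one_div K]
      linarith
  filter_upwards [ae_all_iff.2 key] with t ht
  have h0 : |e' t - u t + φ (y' t)| ≤ 0 := by
    have hlim : Tendsto (fun n : ℕ => (1 + K) * (1 / ((n : ℝ) + 1))) atTop (nhds 0) := by
      simpa using tendsto_one_div_add_atTop_nhds_zero_nat.const_mul (1 + K)
    refine ge_of_tendsto hlim (Eventually.of_forall fun n => ?_)
    rw [mul_one_div]
    exact ht n
  have := abs_eq_zero.1 (le_antisymm h0 (abs_nonneg _))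
  linarith

theorem normT_steadyState_le {G : ℂ → ℂ} {φ a b c d : ℝ → ℝ}
    (hφ : HasSlopeSectorBounds φ a b c d) (hG : IsProperStable G) {T : ℝ} (hT : 0 < T) {A : ℝ}
    (hA : 0 < A) {r : ℝ≥0∞} (hr : 0 < r) (hmar : r ≤ margin hT G (c A) (d A))
    {u y y' : ℝ → ℝ} (h : IsResponse hT G φ u y y') (hb : ∀ᵐ t ∂timeAxis, |y' t| ≤ A) :
    normT T y' ≤ r⁻¹ * normT T u := by
  obtain ⟨hu, e, e', ⟨hout, hloop⟩, he, hy⟩ := h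
  have hsteady := steadyState_loop_eq hφ hT hu.2 hloop he hy hA hb
  refine normT_le_of_le_margin hT (he.1 T hT.le) (hy.1 T hT.le)
    (fun k hk => he.2.1.fourierCoeffOn_even hT hk) (fun k hk => hy.2.1.fourierCoeffOn_even hT hk)
    (fourierCoeffOn_steadyState_output hG hT hout he hy) (w := fun t => φ (y' t))
    (hφ.continuous.comp_aestronglyMeasurable (hy.1 T hT.le).aestronglyMeasurable)
    (hφ.sector_le hA) ?_ (ae_horizon_of_timeAxis hsteady T) hr hmar
  filter_upwards [ae_horizon_of_timeAxis hb T] with t ht using hφ.abs_sector_le hA ht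

/-- Shifting and subtracting multiplies the `k`-th coefficients of `e'` and `y'` by the same number,
so the increments are again related by `G`. Their nonlinear term is `φ(y'(t + s)) - φ(y'(t))`, for
which the slope interval is a sector. -/
theorem normT_shift_steadyState_sub_le {G : ℂ → ℂ} {φ a b c d : ℝ → ℝ}
    (hφ : HasSlopeSectorBounds φ a b c d) (hG : IsProperStable G) {T : ℝ} (hT : 0 < T) {A : ℝ}
    (hA : 0 < A) {r : ℝ≥0∞} (hr : 0 < r) (hmar : r ≤ margin hT G (a A) (b A))
    {u y y' : ℝ → ℝ} (h : IsResponse hT G φ u y y') (hb : ∀ᵐ t ∂timeAxis, |y' t| ≤ A)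
    {s : ℝ} (hs : 0 ≤ s) :
    normT T (fun t => y' (t + s) - y' t) ≤ r⁻¹ * normT T fun t => u (t + s) - u t := by
  obtain ⟨hu, e, e', ⟨hout, hloop⟩, he, hy⟩ := h
  have hsteady := steadyState_loop_eq hφ hT hu.2 hloop he hy hA hb
  have hsub : ∀ {f : ℝ → ℝ}, IsL2e f → IsHalfWavePeriodic T f → ∀ k : ℤ,
      fourierCoeffOn hT (fun t => ((f (t + s) - f t : ℝ) : ℂ)) k =
        (Complex.exp (((k * (2 * Real.pi / T) : ℝ) * Complex.I) * s) - 1) *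
          fourierCoeffOn hT (fun t => (f t : ℂ)) k := by
    intro f hf hper k
    rw [fourierCoeffOn_sub' hT (f := fun t => f (t + s)) (hf.shift hs T hT.le) (hf T hT.le),
      fourierCoeffOn_shift hT (hper.periodic hT) hs]
    ring
  have hcont := hφ.continuous
  refine normT_le_of_le_margin hT (e := fun t => e' (t + s) - e' t)
    (((he.1.shift hs).sub he.1) T hT.le) (((hy.1.shift hs).sub hy.1) T hT.le)
    (fun k hk => ?_) (fun k hk => ?_) (fun k => ?_) (w := fun t => φ (y' (t + s)) - φ (y' t))
    ?_ (hφ.slope_le hA) ?_ ?_ hr hmar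
  · rw [hsub he.1 he.2.1, he.2.1.fourierCoeffOn_even hT hk, mul_zero]
  · rw [hsub hy.1 hy.2.1, hy.2.1.fourierCoeffOn_even hT hk, mul_zero]
  · rw [hsub he.1 he.2.1, hsub hy.1 hy.2.1, fourierCoeffOn_steadyState_output hG hT hout he hy]
    ring
  · exact (hcont.comp_aestronglyMeasurable (hy.1.shift hs T hT.le).aestronglyMeasurable).sub
      (hcont.comp_aestronglyMeasurable (hy.1 T hT.le).aestronglyMeasurable)
  · filter_upwards [ae_horizon_of_timeAxis hb T,
      ae_horizon_of_timeAxis (ae_timeAxis_shift hb hs) T] with t h1 h2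
    exact hφ.abs_slope_le hA h2 h1
  · filter_upwards [ae_horizon_of_timeAxis hsteady T,
      ae_horizon_of_timeAxis (ae_timeAxis_shift hsteady hs) T] with t h1 h2
    rw [h1, h2]
    ring

/-! ### Weak derivatives, primitives and increments -/

theorem exists_Icc_of_isCompact_subset_Ioo {T : ℝ} (hT : 0 < T) {K : Set ℝ} (hK : IsCompact K)
    (h : K ⊆ Set.Ioo 0 T) : ∃ a b : ℝ, 0 < a ∧ b < T ∧ K ⊆ Set.Icc a b := by
  rcases K.eq_empty_or_nonempty with rfl | hne
  · exact ⟨T, 0, hT, hT, Set.empty_subset _⟩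
  · obtain ⟨a, ha⟩ := hK.exists_isLeast hne
    obtain ⟨b, hb⟩ := hK.exists_isGreatest hne
    exact ⟨a, b, (h ha.1).1, (h hb.1).2, fun x hx => ⟨ha.2 hx, hb.2 hx⟩⟩

theorem integral_horizon {T : ℝ} (hT : 0 ≤ T) (f : ℝ → ℝ) :
    ∫ t, f t ∂(horizon T) = ∫ t in (0 : ℝ)..T, f t := by
  rw [horizon_eq_restrict_Ioc, intervalIntegral.integral_of_le hT]

theorem memLp_horizon_intervalIntegrable {T : ℝ} (hT : 0 ≤ T) {f : ℝ → ℝ}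
    (hf : MemLp f 2 (horizon T)) : IntervalIntegrable f volume 0 T := by
  have : IsFiniteMeasure (horizon T) := by unfold horizon; infer_instance
  rw [intervalIntegrable_iff_integrableOn_Icc_of_le hT]
  exact hf.integrable (by norm_num)

/-- Integration by parts for a primitive against a test function. -/
theorem integral_primitive_mul_deriv {T : ℝ} {v : ℝ → ℝ}
    (hv : IntervalIntegrable v volume 0 T) {ψ : ℝ → ℝ} (hψ : ContDiff ℝ 1 ψ)
    (hsupp : tsupport ψ ⊆ Set.Ioo 0 T) :
    ∫ t in (0 : ℝ)..T, (∫ s in (0 : ℝ)..t, v s) * deriv ψ t =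
      -∫ t in (0 : ℝ)..T, v t * ψ t := by
  have h1 := hv.absolutelyContinuousOnInterval_intervalIntegral (c := 0) Set.left_mem_uIcc
  have h2 : AbsolutelyContinuousOnInterval ψ 0 T :=
    hψ.contDiffOn.absolutelyContinuousOnInterval
  rw [h1.integral_mul_deriv_eq_deriv_mul h2]
  have hψT : ψ T = 0 := image_eq_zero_of_notMem_tsupport fun h => (hsupp h).2.false
  rw [hψT, intervalIntegral.integral_same]
  have h3 : ∫ t in (0 : ℝ)..T, deriv (fun x => ∫ s in (0 : ℝ)..x, v s) t * ψ t =
      ∫ t in (0 : ℝ)..T, v t * ψ t := by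
    refine intervalIntegral.integral_congr_ae ?_
    filter_upwards [hv.ae_hasDerivAt_integral] with t ht hmem
    rw [(ht (Set.uIoc_subset_uIcc hmem) 0 Set.left_mem_uIcc).deriv]
  rw [h3]
  ring

/-- **du Bois-Reymond**: a function with a weak derivative is a primitive of it. -/
theorem HasWeakDeriv.exists_ae_eq_primitive {T : ℝ} (hT : 0 < T) {u v : ℝ → ℝ}
    (hu : MemLp u 2 (horizon T)) (hv : MemLp v 2 (horizon T)) (h : HasWeakDeriv T u v) :
    ∃ c : ℝ, ∀ᵐ t ∂horizon T, u t = c + ∫ s in (0 : ℝ)..t, v s := by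
  have hui := memLp_horizon_intervalIntegrable hT.le hu
  have hvi := memLp_horizon_intervalIntegrable hT.le hv
  set V : ℝ → ℝ := fun t => ∫ s in (0 : ℝ)..t, v s with hV
  have hVac : AbsolutelyContinuousOnInterval V 0 T :=
    hvi.absolutelyContinuousOnInterval_intervalIntegral (c := 0) Set.left_mem_uIcc
  have hVi : IntervalIntegrable V volume 0 T := hVac.continuousOn.intervalIntegrable
  set W : ℝ → ℝ := fun t => u t - V t with hW
  have hWi : IntervalIntegrable W volume 0 T := hui.sub hVi
  have hW0 : ∀ ψ : ℝ → ℝ, ContDiff ℝ 1 ψ → HasCompactSupport ψ → tsupport ψ ⊆ Set.Ioo 0 T →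
      ∫ t in (0 : ℝ)..T, W t * deriv ψ t = 0 := by
    intro ψ h1 h2 h3
    have h4 := h ψ h1 h2 h3
    rw [integral_horizon hT.le, integral_horizon hT.le] at h4
    have hc : ContinuousOn (deriv ψ) (Set.uIcc 0 T) := (h1.continuous_deriv le_rfl).continuousOn
    have h5 : ∀ t, W t * deriv ψ t = u t * deriv ψ t - V t * deriv ψ t := fun t => sub_mul _ _ _
    simp_rw [h5]
    rw [intervalIntegral.integral_sub (hui.mul_continuousOn hc) (hVi.mul_continuousOn hc), h4,
      integral_primitive_mul_deriv hvi h1 h3, sub_self]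
  -- A unit-mass test function inside `(0, T)`. Subtracting its multiple from any test function `η`
  -- makes the integral zero, so that the primitive of the difference is itself an admissible test
  -- function.
  let bump : ContDiffBump (T / 2) := ⟨T / 8, T / 4, by positivity, by linarith⟩
  set η₀ : ℝ → ℝ := bump.normed volume with hη₀
  have hη₀c : ContDiff ℝ 1 η₀ := bump.contDiff_normed
  have hη₀s : tsupport η₀ ⊆ Set.Ioo 0 T := by
    rw [hη₀, bump.tsupport_normed_eq, Real.closedBall_eq_Icc]
    intro t ht
    have h1 : T / 2 - T / 4 ≤ t := ht.1
    have h2 : t ≤ T / 2 + T / 4 := ht.2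
    constructor <;> linarith
  have hη₀k : HasCompactSupport η₀ := bump.hasCompactSupport_normed
  have hη₀1 : ∫ t, η₀ t = 1 := bump.integral_normed
  set c := ∫ t in (0 : ℝ)..T, W t * η₀ t with hc
  refine ⟨c, ?_⟩
  have hloc : LocallyIntegrableOn (fun t => W t - c) (Set.Ioo 0 T) volume := by
    refine IntegrableOn.locallyIntegrableOn ?_
    exact ((hWi.sub (intervalIntegrable_const (c := c))).1).mono_set Set.Ioo_subset_Ioc_self
  have key : ∀ᵐ t : ℝ, t ∈ Set.Ioo 0 T → W t - c = 0 := by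
    refine isOpen_Ioo.ae_eq_zero_of_integral_contDiff_smul_eq_zero hloc fun η hη hηk hηs => ?_
    have hηc : Continuous η := hη.continuous
    set I := ∫ t, η t with hI
    set ζ : ℝ → ℝ := fun t => η t - I * η₀ t with hζ
    have hζc : Continuous ζ := hηc.sub (hη₀c.continuous.const_mul I)
    obtain ⟨a, b, ha, hb, hab⟩ := exists_Icc_of_isCompact_subset_Ioo hT
      (hηk.isCompact.union hη₀k.isCompact) (Set.union_subset hηs hη₀s)
    have hζ0 : ∀ t, t ∉ Set.Icc a b → ζ t = 0 := by
      intro t ht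
      have h1 : η t = 0 := image_eq_zero_of_notMem_tsupport fun h => ht (hab (Or.inl h))
      have h2 : η₀ t = 0 := image_eq_zero_of_notMem_tsupport fun h => ht (hab (Or.inr h))
      simp [hζ, h1, h2]
    have hηint : Integrable η := hηc.integrable_of_hasCompactSupport hηk
    have hη₀int : Integrable η₀ := hη₀c.continuous.integrable_of_hasCompactSupport hη₀k
    have hζint : ∫ t, ζ t = 0 := by
      rw [hζ, integral_sub hηint (hη₀int.const_mul I), integral_const_mul, hη₀1, ← hI]
      ring
    set ψ : ℝ → ℝ := fun t => ∫ s in (0 : ℝ)..t, ζ s with hψ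
    have hder : ∀ t, HasDerivAt ψ (ζ t) t := fun t =>
      intervalIntegral.integral_hasDerivAt_right (hζc.intervalIntegrable _ _)
        (hζc.stronglyMeasurableAtFilter _ _) hζc.continuousAt
    have hderiv : deriv ψ = ζ := funext fun t => (hder t).deriv
    have hψ1 : ContDiff ℝ 1 ψ := by
      rw [contDiff_one_iff_deriv, hderiv]
      exact ⟨fun t => (hder t).differentiableAt, hζc⟩
    have hψ0 : ∀ t, t ∉ Set.Icc a b → ψ t = 0 := by
      intro t ht
      rw [Set.mem_Icc, not_and_or, not_le, not_le] at ht
      rcases ht with ht | ht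
      · have h1 : ∫ s in (0 : ℝ)..t, ζ s = ∫ s in (0 : ℝ)..t, (0 : ℝ) := by
          refine intervalIntegral.integral_congr fun s hs => hζ0 s fun hs' => ?_
          have h2 : s ≤ max 0 t := hs.2
          exact absurd hs'.1 (not_le.2 (h2.trans_lt (max_lt ha ht)))
        exact h1.trans (by simp)
      · refine (intervalIntegral.integral_eq_integral_of_support_subset fun s hs => ?_).trans hζint
        by_contra hs'
        refine hs (hζ0 s fun h3 => hs' ⟨ha.trans_le h3.1, h3.2.trans ht.le⟩)
    have hψt : tsupport ψ ⊆ Set.Icc a b :=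
      closure_minimal (fun t ht => by
        by_contra h1
        exact ht (hψ0 t h1)) isClosed_Icc
    have hψk : HasCompactSupport ψ := isCompact_Icc.of_isClosed_subset (isClosed_tsupport ψ) hψt
    have hfin := hW0 ψ hψ1 hψk fun t ht =>
      ⟨ha.trans_le (hψt ht).1, (hψt ht).2.trans_lt hb⟩
    rw [hderiv] at hfin
    have e1 : ∀ f : ℝ → ℝ, ∫ t, η t • f t = ∫ t in (0 : ℝ)..T, η t * f t := by
      intro f
      refine (intervalIntegral.integral_eq_integral_of_support_subset fun s hs => ?_).symm
      have h1 : s ∈ tsupport η := by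
        refine subset_tsupport _ fun h0 => hs ?_
        simp [h0]
      exact Set.Ioo_subset_Ioc_self (hηs h1)
    have e2 : I = ∫ t in (0 : ℝ)..T, η t := by
      rw [hI]
      refine (intervalIntegral.integral_eq_integral_of_support_subset fun s hs => ?_).symm
      exact Set.Ioo_subset_Ioc_self (hηs (subset_tsupport _ hs))
    rw [e1]
    have i1 : IntervalIntegrable (fun t => W t * η t) volume 0 T :=
      hWi.mul_continuousOn hηc.continuousOn
    have i2 : IntervalIntegrable (fun t => W t * η₀ t) volume 0 T :=
      hWi.mul_continuousOn hη₀c.continuous.continuousOn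
    have e3 : ∫ t in (0 : ℝ)..T, W t * ζ t = (∫ t in (0 : ℝ)..T, W t * η t) - I * c := by
      rw [hc, ← intervalIntegral.integral_const_mul,
        ← intervalIntegral.integral_sub i1 (i2.const_mul I)]
      congr 1
      ext t
      simp only [hζ]
      ring
    have e4 : ∫ t in (0 : ℝ)..T, η t * (W t - c) = (∫ t in (0 : ℝ)..T, W t * η t) - I * c := by
      rw [e2, mul_comm, ← intervalIntegral.integral_const_mul,
        ← intervalIntegral.integral_sub i1 ((hηc.intervalIntegrable _ _).const_mul c)]
      congr 1
      ext t
      ring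
    rw [e4, ← e3]
    exact hfin
  rw [horizon, ← Measure.restrict_congr_set Ioo_ae_eq_Icc, ae_restrict_iff' measurableSet_Ioo]
  filter_upwards [key] with t ht hmem
  have := ht hmem
  simp only [hW] at this
  linarith

theorem normT_eq_ofReal_sqrt {T : ℝ} (hT : 0 ≤ T) {f : ℝ → ℝ} (hf : MemLp f 2 (horizon T)) :
    normT T f = ENNReal.ofReal (√(∫ t in (0 : ℝ)..T, f t ^ 2)) := by
  rw [normT, hf.eLpNorm_eq_integral_rpow_norm (by norm_num) (by norm_num),
    ← integral_horizon hT, Real.sqrt_eq_rpow]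
  congr 2
  · simp
  · norm_num

/-- Cauchy–Schwarz, from the nonnegativity of the variance about the mean `m`. -/
theorem sq_integral_le {f : ℝ → ℝ} {a b : ℝ} (hab : a ≤ b)
    (hf : IntervalIntegrable f volume a b)
    (hf2 : IntervalIntegrable (fun t => f t ^ 2) volume a b) :
    (∫ t in a..b, f t) ^ 2 ≤ (b - a) * ∫ t in a..b, f t ^ 2 := by
  rcases hab.eq_or_lt with rfl | hlt
  · simp
  have hba : 0 < b - a := sub_pos.2 hlt
  set I := ∫ t in a..b, f t with hI
  set m := I / (b - a) with hm
  have h1 : 0 ≤ ∫ t in a..b, (f t - m) ^ 2 :=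
    intervalIntegral.integral_nonneg hab fun t _ => sq_nonneg _
  have h2 : ∫ t in a..b, (f t - m) ^ 2 =
      (∫ t in a..b, f t ^ 2) - 2 * m * I + m ^ 2 * (b - a) := by
    have h3 : ∀ t, (f t - m) ^ 2 = f t ^ 2 - 2 * m * f t + m ^ 2 := fun t => by ring
    simp_rw [h3]
    rw [intervalIntegral.integral_add (hf2.sub (hf.const_mul _)) intervalIntegrable_const,
      intervalIntegral.integral_sub hf2 (hf.const_mul _), intervalIntegral.integral_const_mul,
      intervalIntegral.integral_const, smul_eq_mul, mul_comm (b - a)]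
  rw [h2] at h1
  have h4 : m * (b - a) = I := div_mul_cancel₀ _ hba.ne'
  have h5 : 0 ≤ (b - a) * ((∫ t in a..b, f t ^ 2) - 2 * m * I + m ^ 2 * (b - a)) :=
    mul_nonneg hba.le h1
  have h6 : (b - a) * ((∫ t in a..b, f t ^ 2) - 2 * m * I + m ^ 2 * (b - a)) =
      (b - a) * (∫ t in a..b, f t ^ 2) - I ^ 2 := by
    rw [← h4]
    ring
  linarith

/-- The mean over a period of the increments of the primitive of a periodic function. -/
theorem integral_primitive_increment {T : ℝ} {g : ℝ → ℝ} (hg : Function.Periodic g T)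
    (hi : ∀ a b : ℝ, IntervalIntegrable g volume a b) (s : ℝ) :
    ∫ t in (0 : ℝ)..T, (∫ x in t..t + s, g x) = s * ∫ x in (0 : ℝ)..T, g x := by
  set W : ℝ → ℝ := fun t => ∫ x in (0 : ℝ)..t, g x with hW
  have hWc : Continuous W := intervalIntegral.continuous_primitive hi 0
  have hWi : ∀ a b, IntervalIntegrable W volume a b := fun a b => hWc.intervalIntegrable a b
  have h1 : ∀ t, ∫ x in t..t + s, g x = W (t + s) - W t := fun t =>
    (intervalIntegral.integral_interval_sub_left (hi _ _) (hi _ _)).symm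
  have h2 : ∀ t, W (t + T) = W t + W T := by
    intro t
    have h3 := intervalIntegral.integral_interval_sub_left (hi 0 (t + T)) (hi 0 t)
    rw [hg.intervalIntegral_add_eq t 0, zero_add] at h3
    simp only [hW]
    linarith
  simp_rw [h1]
  have hWs : IntervalIntegrable (fun t => W (t + s)) volume 0 T :=
    (hWc.comp (continuous_add_const s)).intervalIntegrable _ _
  rw [intervalIntegral.integral_sub hWs (hWi _ _), intervalIntegral.integral_comp_add_right W s,
    zero_add]
  have h4 : ∫ t in T..T + s, W t = (∫ t in (0 : ℝ)..s, W t) + s * W T := by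
    have h5 := intervalIntegral.integral_comp_add_right (a := 0) (b := s) W T
    rw [zero_add, add_comm s T] at h5
    rw [← h5]
    simp_rw [h2]
    rw [intervalIntegral.integral_add (hWi _ _) intervalIntegrable_const,
      intervalIntegral.integral_const, smul_eq_mul, sub_zero]
  have h6 := intervalIntegral.integral_add_adjacent_intervals (hWi 0 s) (hWi s (T + s))
  have h7 := intervalIntegral.integral_add_adjacent_intervals (hWi 0 T) (hWi T (T + s))
  linarith

/-- A half-wave periodic `H¹` signal is the primitive of a periodic signal. -/
theorem IsH1WithDeriv.exists_periodic_primitive {T : ℝ} (hT : 0 < T) {u du : ℝ → ℝ}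
    (hu : IsHalfWavePeriodic T u) (h : IsH1WithDeriv T u du) :
    ∃ (p : ℝ → ℝ) (c : ℝ), Function.Periodic p T ∧ p =ᵐ[horizon T] du ∧
      ∀ᵐ t ∂timeAxis, u t = c + ∫ x in (0 : ℝ)..t, p x := by
  obtain ⟨hu2, hdu2, hweak⟩ := h
  obtain ⟨c, hc⟩ := hweak.exists_ae_eq_primitive hT hu2 hdu2
  set p : ℝ → ℝ := fun t => du (toIcoMod hT 0 t) with hp
  have hper : Function.Periodic p T := fun t => by simp [hp]
  have hpdu : ∀ t ∈ Set.Ico 0 T, p t = du t := by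
    intro t ht
    simp only [hp]
    rw [(toIcoMod_eq_self hT).2 (by simpa using ht)]
  have hpae : p =ᵐ[horizon T] du := by
    rw [horizon, ← Measure.restrict_congr_set Ico_ae_eq_Icc]
    filter_upwards [ae_restrict_mem measurableSet_Ico] with t ht using hpdu t ht
  have hpint : ∀ a b : ℝ, IntervalIntegrable p volume a b :=
    hper.intervalIntegrable₀ hT.ne'
      (memLp_horizon_intervalIntegrable hT.le (hdu2.ae_eq hpae.symm))
  refine ⟨p, c, hper, hpae, ?_⟩
  set U : ℝ → ℝ := fun t => c + ∫ x in (0 : ℝ)..t, p x with hU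
  have hUc : Continuous U := continuous_const.add (intervalIntegral.continuous_primitive hpint 0)
  have huU : ∀ᵐ t ∂horizon T, u t = U t := by
    have hmem : ∀ᵐ t ∂horizon T, t ∈ Set.Icc 0 T := ae_restrict_mem measurableSet_Icc
    filter_upwards [hc, hmem] with t ht hm
    rw [ht]
    simp only [hU]
    congr 1
    refine intervalIntegral.integral_congr_ae ?_
    have h1 := (ae_restrict_iff' measurableSet_Icc).1 (show ∀ᵐ x ∂horizon T, p x = du x from hpae)
    filter_upwards [h1] with x hx hxm
    rw [Set.uIoc_of_le hm.1] at hxm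
    exact (hx ⟨hxm.1.le, hxm.2.trans hm.2⟩).symm
  have hhalf : ∀ t ∈ Set.Icc 0 (T / 2), U (t + T / 2) = -U t := by
    have h1 : ∀ᵐ t ∂horizon (T / 2), U (t + T / 2) = -U t := by
      have h2 := (ae_restrict_iff' measurableSet_Icc).1 huU
      rw [horizon, ae_restrict_iff' measurableSet_Icc]
      filter_upwards [h2, ae_comp_add_right h2 (T / 2), ae_timeAxis_iff.1 hu] with t h3 h4 h5 h6
      rw [← h4 ⟨by linarith [h6.1], by linarith [h6.2]⟩, h5 h6.1,
        h3 ⟨h6.1, by linarith [h6.2]⟩]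
    exact Measure.eqOn_Icc_of_ae_eq volume (by positivity) h1
      (hUc.comp (continuous_add_const _)).continuousOn hUc.neg.continuousOn
  -- Weak differentiability on `[0, T]` alone would allow a jump between periods. The half-wave
  -- symmetry excludes it: `U(T) = -U(T/2) = U(0)`.
  have hp0 : ∫ x in (0 : ℝ)..T, p x = 0 := by
    have h1 := hhalf 0 ⟨le_rfl, by positivity⟩
    have h2 := hhalf (T / 2) ⟨by positivity, le_rfl⟩
    rw [zero_add] at h1
    rw [add_halves, h1, neg_neg] at h2
    simp only [hU, intervalIntegral.integral_same] at h2
    linarith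
  have hUper : ∀ t, U (t + T) = U t := by
    intro t
    have h3 := intervalIntegral.integral_interval_sub_left (hpint 0 (t + T)) (hpint 0 t)
    rw [hper.intervalIntegral_add_eq t 0, zero_add, hp0] at h3
    simp only [hU]
    linarith
  refine ae_timeAxis_of_periodic_of_horizon hT ?_ huU
  filter_upwards [hu.periodic hT] with t h1 h2
  rw [h1, h2]
  exact (hUper t).symm

/-- The increment is the integral of the periodic derivative over `[t, t + s]`. Cauchy–Schwarz gives
one factor `s`, averaging the remaining integral over a period gives the other. -/
theorem normT_shift_sub_le {T : ℝ} (hT : 0 < T) {u du : ℝ → ℝ} (hL : IsL2e u)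
    (hu : IsHalfWavePeriodic T u) (h : IsH1WithDeriv T u du) {s : ℝ} (hs : 0 ≤ s) :
    normT T (fun t => u (t + s) - u t) ≤ ENNReal.ofReal s * normT T du := by
  obtain ⟨p, c, hper, hpae, hup⟩ := h.exists_periodic_primitive hT hu
  have hp2 : MemLp p 2 (horizon T) := h.2.1.ae_eq hpae.symm
  have hpint : ∀ a b : ℝ, IntervalIntegrable p volume a b :=
    hper.intervalIntegrable₀ hT.ne' (memLp_horizon_intervalIntegrable hT.le hp2)
  have hper2 : Function.Periodic (fun t => p t ^ 2) T := fun t => by simp only [hper t]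
  have hpint2 : ∀ a b : ℝ, IntervalIntegrable (fun t => p t ^ 2) volume a b := by
    refine hper2.intervalIntegrable₀ hT.ne' ?_
    rw [intervalIntegrable_iff_integrableOn_Icc_of_le hT.le]
    exact hp2.integrable_sq
  have hd : MemLp (fun t => u (t + s) - u t) 2 (horizon T) := ((hL.shift hs).sub hL) T hT.le
  have hdu : normT T du = normT T p := eLpNorm_congr_ae hpae.symm
  rw [hdu, normT_eq_ofReal_sqrt hT.le hd, normT_eq_ofReal_sqrt hT.le hp2,
    ← ENNReal.ofReal_mul hs]
  refine ENNReal.ofReal_le_ofReal ?_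
  rw [Real.sqrt_le_left (by positivity), mul_pow, Real.sq_sqrt
    (intervalIntegral.integral_nonneg hT.le fun t _ => sq_nonneg _)]
  set W : ℝ → ℝ := fun t => ∫ x in (0 : ℝ)..t, p x ^ 2 with hW
  have hWc : Continuous W := intervalIntegral.continuous_primitive hpint2 0
  have h1 : ∀ t, ∫ x in t..t + s, p x ^ 2 = W (t + s) - W t := fun t =>
    (intervalIntegral.integral_interval_sub_left (hpint2 _ _) (hpint2 _ _)).symm
  have hWcont : Continuous fun t => ∫ x in t..t + s, p x ^ 2 := by
    simp_rw [h1]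
    exact (hWc.comp (continuous_add_const s)).sub hWc
  calc ∫ t in (0 : ℝ)..T, (u (t + s) - u t) ^ 2
      ≤ ∫ t in (0 : ℝ)..T, s * ∫ x in t..t + s, p x ^ 2 := by
        rw [← integral_horizon hT.le, ← integral_horizon hT.le]
        refine integral_mono_ae hd.integrable_sq ?_ ?_
        · exact ((continuous_const.mul hWcont).continuousOn.integrableOn_Icc)
        · filter_upwards [ae_horizon_of_timeAxis hup T,
            ae_horizon_of_timeAxis (ae_timeAxis_shift hup hs) T] with t h2 h3
          have h4 : u (t + s) - u t = ∫ x in t..t + s, p x := by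
            rw [h2, h3, add_sub_add_left_eq_sub]
            exact intervalIntegral.integral_interval_sub_left (hpint _ _) (hpint _ _)
          rw [h4]
          have h5 := sq_integral_le (show t ≤ t + s by linarith) (hpint _ _) (hpint2 _ _)
          rwa [add_sub_cancel_left] at h5
    _ = s ^ 2 * ∫ t in (0 : ℝ)..T, p t ^ 2 := by
        rw [intervalIntegral.integral_const_mul, integral_primitive_increment hper2 hpint2]
        ring

/-! ### From bounded difference quotients to a weak derivative -/

/-- Riesz representation of a functional that is bounded with respect to a map into a Hilbert
space. -/
theorem exists_inner_eq_of_abs_le {V H : Type*} [AddCommGroup V] [Module ℝ V]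
    [NormedAddCommGroup H] [InnerProductSpace ℝ H] [CompleteSpace H] (J : V →ₗ[ℝ] H)
    (L : V →ₗ[ℝ] ℝ) {C : ℝ} (hC : 0 ≤ C) (h : ∀ v, |L v| ≤ C * ‖J v‖) :
    ∃ g : H, ‖g‖ ≤ C ∧ ∀ v, L v = inner ℝ g (J v) := by
  -- The bound forces `L` to vanish on the kernel of `J`, so `L` factors through the range of `J`;
  -- Hahn–Banach then extends it with the same norm.
  have hker : L ∈ (LinearMap.ker J).dualAnnihilator := by
    rw [Submodule.mem_dualAnnihilator]
    intro v hv
    have h1 := h v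
    rw [LinearMap.mem_ker.1 hv, norm_zero, mul_zero] at h1
    exact abs_eq_zero.1 (le_antisymm h1 (abs_nonneg _))
  rw [← LinearMap.range_dualMap_eq_dualAnnihilator_ker] at hker
  obtain ⟨f, hf⟩ := hker
  have hfv : ∀ v, f (J v) = L v := fun v => by rw [← hf]; rfl
  have hfb : ∀ x : LinearMap.range J, ‖(f.domRestrict (LinearMap.range J)) x‖ ≤ C * ‖x‖ := by
    rintro ⟨_, v, rfl⟩
    rw [LinearMap.domRestrict_apply]
    change ‖f (J v)‖ ≤ C * ‖J v‖
    rw [hfv]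
    exact h v
  obtain ⟨g, hg, hgn⟩ := exists_extension_norm_eq (LinearMap.range J)
    ((f.domRestrict (LinearMap.range J)).mkContinuous C hfb)
  refine ⟨(InnerProductSpace.toDual ℝ H).symm g, ?_, fun v => ?_⟩
  · rw [LinearIsometryEquiv.norm_map, hgn]
    exact LinearMap.mkContinuous_norm_le _ hC _
  · rw [InnerProductSpace.toDual_symm_apply]
    have h1 := hg ⟨J v, v, rfl⟩
    rw [h1, ← hfv]
    rfl

/-- The test functions of class `C¹` with compact support in `(0, T)`. -/
def testFunctions (T : ℝ) : Submodule ℝ (ℝ → ℝ) where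
  carrier := {ψ | ContDiff ℝ 1 ψ ∧ HasCompactSupport ψ ∧ tsupport ψ ⊆ Set.Ioo 0 T}
  zero_mem' := ⟨contDiff_const, HasCompactSupport.zero, by
    rw [tsupport_eq_empty_iff.2 rfl]
    exact Set.empty_subset _⟩
  add_mem' := fun ⟨h1, h2, h3⟩ ⟨k1, k2, k3⟩ =>
    ⟨h1.add k1, h2.add k2, (tsupport_add _ _).trans (Set.union_subset h3 k3)⟩
  smul_mem' := fun c _ ⟨h1, h2, h3⟩ =>
    ⟨contDiff_const.smul h1, h2.smul_left (f := fun _ => c),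
      (tsupport_smul_subset_right (fun _ => c) _).trans h3⟩

theorem integrable_mul_of_memLp_two {μ : Measure ℝ} {f g : ℝ → ℝ} (hf : MemLp f 2 μ)
    (hg : MemLp g 2 μ) : Integrable (fun t => f t * g t) μ :=
  hf.integrable_mul hg

theorem abs_integral_mul_le {T : ℝ} {f g : ℝ → ℝ} (hf : MemLp f 2 (horizon T))
    (hg : MemLp g 2 (horizon T)) :
    |∫ t, f t * g t ∂horizon T| ≤ (normT T f).toReal * (normT T g).toReal := by
  have h1 := abs_real_inner_le_norm hf.toLp hg.toLp
  rw [Lp.norm_toLp, Lp.norm_toLp, L2.inner_def] at h1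
  refine le_trans (le_of_eq ?_) h1
  congr 1
  refine integral_congr_ae ?_
  filter_upwards [hf.coeFn_toLp, hg.coeFn_toLp] with t h2 h3
  rw [h2, h3]
  exact mul_comm _ _

/-- Summation by parts: moving a difference quotient from the test function to the signal. -/
theorem integral_mul_shift_test {T : ℝ} {y ψ : ℝ → ℝ} {a b h : ℝ} (ha : 0 < a) (hh : 0 ≤ h)
    (hb : b + h ≤ T) (hψ : ∀ t, t ∉ Set.Icc a b → ψ t = 0) :
    ∫ t, y t * ψ (t - h) ∂horizon T = ∫ t, y (t + h) * ψ t ∂horizon T := by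
  unfold horizon
  -- Both integrands vanish off `[0, T]`, as `b + h ≤ T` keeps the shifted support inside; on `ℝ`
  -- the integral is translation invariant.
  rw [setIntegral_eq_integral_of_forall_compl_eq_zero (fun t ht => ?_),
    setIntegral_eq_integral_of_forall_compl_eq_zero (fun t ht => ?_)]
  · rw [← integral_add_right_eq_self (fun t => y t * ψ (t - h)) h]
    simp
  · rw [hψ t fun h1 => ht ⟨ha.le.trans h1.1, by linarith [h1.2]⟩, mul_zero]
  · rw [hψ (t - h) fun h1 => ht ⟨by linarith [h1.1], by linarith [h1.2]⟩, mul_zero]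

/-- The derivative of the test function is the limit of backward difference quotients; summation by
parts turns these into forward quotients of `y`, which stay within `t ≥ 0` and are bounded by `C`.
-/
theorem abs_integral_mul_deriv_le {T : ℝ} (hT : 0 < T) {y : ℝ → ℝ} (hy : IsL2e y) {C : ℝ≥0∞}
    (hC : C ≠ ⊤)
    (hdiff : ∀ h : ℝ, 0 ≤ h → normT T (fun t => y (t + h) - y t) ≤ C * ENNReal.ofReal h)
    {ψ : ℝ → ℝ} (hψ : ψ ∈ testFunctions T) (hψ2 : MemLp ψ 2 (horizon T)) :
    |∫ t, y t * deriv ψ t ∂horizon T| ≤ C.toReal * (normT T ψ).toReal := by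
  obtain ⟨h1, h2, h3⟩ := hψ
  have hfin : IsFiniteMeasure (horizon T) := by unfold horizon; infer_instance
  obtain ⟨a, b, ha, hb, hab⟩ := exists_Icc_of_isCompact_subset_Ioo hT h2.isCompact h3
  obtain ⟨K, hK⟩ := h1.lipschitzWith_of_hasCompactSupport h2 one_ne_zero
  have hy2 := hy T hT.le
  have hyi : Integrable y (horizon T) := hy2.integrable (by norm_num)
  have hlim : Tendsto (fun h : ℝ => ∫ t, y t * (h⁻¹ * (ψ t - ψ (t - h))) ∂horizon T)
      (nhdsWithin 0 (Set.Ioi 0)) (nhds (∫ t, y t * deriv ψ t ∂horizon T)) := by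
    refine tendsto_integral_filter_of_dominated_convergence (fun t => |y t| * K) ?_ ?_
      (hyi.abs.mul_const _) ?_
    · refine Eventually.of_forall fun h => hyi.aestronglyMeasurable.mul ?_
      have hc := h1.continuous
      exact Continuous.aestronglyMeasurable (by fun_prop)
    · filter_upwards [self_mem_nhdsWithin] with h hh
      have hh : 0 < h := hh
      refine ae_of_all _ fun t => ?_
      rw [norm_mul, Real.norm_eq_abs]
      refine mul_le_mul_of_nonneg_left ?_ (abs_nonneg _)
      have h5 := hK.dist_le_mul t (t - h)
      rw [Real.dist_eq, Real.dist_eq, sub_sub_cancel, abs_of_pos hh] at h5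
      rw [norm_mul, norm_inv, Real.norm_of_nonneg hh.le, Real.norm_eq_abs,
        inv_mul_le_iff₀ hh, mul_comm]
      exact h5
    · refine ae_of_all _ fun t => Tendsto.const_mul _ ?_
      have hd : HasDerivAt ψ (deriv ψ t) t :=
        (h1.differentiable one_ne_zero t).hasDerivAt
      have hs := hd.tendsto_slope_zero
      have hneg : Tendsto (fun h : ℝ => -h) (nhdsWithin 0 (Set.Ioi 0)) (nhdsWithin 0 {0}ᶜ) := by
        refine tendsto_nhdsWithin_iff.2 ⟨?_, ?_⟩
        · have : Tendsto (fun h : ℝ => -h) (nhds 0) (nhds 0) := by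
            simpa using (continuous_neg (G := ℝ)).tendsto 0
          exact tendsto_nhdsWithin_of_tendsto_nhds this
        · filter_upwards [self_mem_nhdsWithin] with h hh
          exact neg_ne_zero.2 (ne_of_gt hh)
      refine (hs.comp hneg).congr fun h => ?_
      simp only [Function.comp_apply, smul_eq_mul, inv_neg, ← sub_eq_add_neg]
      ring
  have habs := hlim.abs
  refine le_of_tendsto habs ?_
  have hsmall : ∀ᶠ h : ℝ in nhdsWithin 0 (Set.Ioi 0), h < T - b :=
    nhdsWithin_le_nhds (Iio_mem_nhds (sub_pos.2 hb))
  filter_upwards [self_mem_nhdsWithin, hsmall] with h hh hhb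
  have hh : 0 < h := hh
  have hψc := h1.continuous
  have hψs : MemLp (fun t => ψ (t - h)) 2 (horizon T) := by
    obtain ⟨B, hB⟩ := h2.exists_bound_of_continuous hψc
    exact MemLp.of_bound (Continuous.aestronglyMeasurable (by fun_prop)) B
      (ae_of_all _ fun t => hB _)
  have hys : MemLp (fun t => y (t + h)) 2 (horizon T) := hy.shift hh.le T hT.le
  have hshift := integral_mul_shift_test (T := T) (y := y) ha hh.le (by linarith)
    (fun t ht => image_eq_zero_of_notMem_tsupport fun h' => ht (hab h'))
  have hI : ∫ t, y t * (h⁻¹ * (ψ t - ψ (t - h))) ∂horizon T =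
      -(h⁻¹ * ∫ t, (y (t + h) - y t) * ψ t ∂horizon T) := by
    have e1 : ∀ t, y t * (h⁻¹ * (ψ t - ψ (t - h))) =
        h⁻¹ * (y t * ψ t - y t * ψ (t - h)) := fun t => by ring
    have e2 : ∀ t, (y (t + h) - y t) * ψ t = y (t + h) * ψ t - y t * ψ t := fun t => by ring
    simp_rw [e1, e2]
    rw [integral_const_mul,
      integral_sub (integrable_mul_of_memLp_two hy2 hψ2) (integrable_mul_of_memLp_two hy2 hψs),
      integral_sub (integrable_mul_of_memLp_two hys hψ2)
        (integrable_mul_of_memLp_two hy2 hψ2), hshift]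
    ring
  rw [hI, abs_neg, abs_mul, abs_of_pos (inv_pos.2 hh), inv_mul_le_iff₀ hh]
  refine (abs_integral_mul_le (hys.sub hy2) hψ2).trans ?_
  have h6 := ENNReal.toReal_mono (ENNReal.mul_ne_top hC ENNReal.ofReal_ne_top) (hdiff h hh.le)
  rw [ENNReal.toReal_mul, ENNReal.toReal_ofReal hh.le] at h6
  calc (normT T ((fun t => y (t + h)) - y)).toReal * (normT T ψ).toReal
      ≤ (C.toReal * h) * (normT T ψ).toReal :=
        mul_le_mul_of_nonneg_right h6 ENNReal.toReal_nonneg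
    _ = h * (C.toReal * (normT T ψ).toReal) := by ring

/-- A signal with bounded difference quotients is weakly differentiable. -/
theorem exists_isH1WithDeriv_of_shift_le {T : ℝ} (hT : 0 < T) {y : ℝ → ℝ} (hy : IsL2e y)
    {C : ℝ≥0∞} (hC : C ≠ ⊤)
    (hdiff : ∀ h : ℝ, 0 ≤ h → normT T (fun t => y (t + h) - y t) ≤ C * ENNReal.ofReal h) :
    ∃ dy : ℝ → ℝ, IsH1WithDeriv T y dy ∧ normT T dy ≤ C := by
  have hfin : IsFiniteMeasure (horizon T) := by unfold horizon; infer_instance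
  have hy2 := hy T hT.le
  have hbdd : ∀ {f : ℝ → ℝ}, Continuous f → HasCompactSupport f → MemLp f 2 (horizon T) := by
    intro f hf hk
    obtain ⟨B, hB⟩ := hk.exists_bound_of_continuous hf
    exact MemLp.of_bound hf.aestronglyMeasurable B (ae_of_all _ fun t => hB _)
  have hmem : ∀ ψ : testFunctions T, MemLp (ψ : ℝ → ℝ) 2 (horizon T) := fun ψ =>
    hbdd ψ.2.1.continuous ψ.2.2.1
  have hmem' : ∀ ψ : testFunctions T, MemLp (deriv (ψ : ℝ → ℝ)) 2 (horizon T) := fun ψ =>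
    hbdd (ψ.2.1.continuous_deriv le_rfl) ψ.2.2.1.deriv
  have hdiffble : ∀ ψ : testFunctions T, Differentiable ℝ (ψ : ℝ → ℝ) := fun ψ =>
    ψ.2.1.differentiable one_ne_zero
  let J : testFunctions T →ₗ[ℝ] Lp ℝ 2 (horizon T) :=
    { toFun := fun ψ => (hmem ψ).toLp
      map_add' := fun _ _ => rfl
      map_smul' := fun _ _ => rfl }
  let L : testFunctions T →ₗ[ℝ] ℝ :=
    { toFun := fun ψ => -∫ t, y t * deriv (ψ : ℝ → ℝ) t ∂horizon T
      map_add' := fun ψ χ => by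
        have e : ∀ t, y t * deriv ((ψ + χ : testFunctions T) : ℝ → ℝ) t =
            y t * deriv (ψ : ℝ → ℝ) t + y t * deriv (χ : ℝ → ℝ) t := fun t => by
          rw [Submodule.coe_add, deriv_add (hdiffble ψ t) (hdiffble χ t), mul_add]
        simp_rw [e]
        rw [integral_add (integrable_mul_of_memLp_two hy2 (hmem' ψ))
          (integrable_mul_of_memLp_two hy2 (hmem' χ)), neg_add]
      map_smul' := fun c ψ => by
        have e : ∀ t, y t * deriv ((c • ψ : testFunctions T) : ℝ → ℝ) t =
            c * (y t * deriv (ψ : ℝ → ℝ) t) := fun t => by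
          rw [Submodule.coe_smul, deriv_const_smul c (hdiffble ψ t), smul_eq_mul]
          ring
        simp_rw [e]
        rw [integral_const_mul, RingHom.id_apply, smul_eq_mul, mul_neg] }
  obtain ⟨g, hg, hgL⟩ := exists_inner_eq_of_abs_le J L (C := C.toReal) ENNReal.toReal_nonneg
    fun ψ => by
      have h1 := abs_integral_mul_deriv_le hT hy hC hdiff ψ.2 (hmem ψ)
      change |-∫ t, y t * deriv (ψ : ℝ → ℝ) t ∂horizon T| ≤ C.toReal * ‖(hmem ψ).toLp‖
      rw [abs_neg, Lp.norm_toLp]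
      exact h1
  refine ⟨g, ⟨hy2, Lp.memLp g, fun ψ h1 h2 h3 => ?_⟩, ?_⟩
  · have h4 := hgL ⟨ψ, h1, h2, h3⟩
    rw [L2.inner_def] at h4
    have h5 : ∫ t, inner ℝ (g t) (J ⟨ψ, h1, h2, h3⟩ t) ∂horizon T =
        ∫ t, g t * ψ t ∂horizon T := by
      refine integral_congr_ae ?_
      filter_upwards [(hmem ⟨ψ, h1, h2, h3⟩).coeFn_toLp] with t ht
      change inner ℝ (g t) (((hmem ⟨ψ, h1, h2, h3⟩).toLp : Lp ℝ 2 (horizon T)) t) = _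
      rw [ht]
      exact mul_comm _ _
    rw [h5] at h4
    change -∫ t, y t * deriv ψ t ∂horizon T = _ at h4
    linarith
  · rw [Lp.norm_def] at hg
    exact (ENNReal.toReal_le_toReal (Lp.eLpNorm_ne_top g) hC).1 hg

end Lure

theorem lemma2 (G : ℂ → ℂ) (φ a b c d : ℝ → ℝ) (hφ : Lure.HasSlopeSectorBounds φ a b c d)
    (hcond : Lure.Condition G φ) (hpp : Lure.PeriodPreserving G φ)
    (T : ℝ) (hT : 0 < T) (A : ℝ) (hA : 0 < A) :
    (∀ r : ℝ≥0∞, Lure.margin hT G (c A) (d A) = r → 0 < r →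
      (∀ u y y' : ℝ → ℝ, Lure.IsResponse hT G φ u y y' → Lure.normSup y ≤ ENNReal.ofReal A →
        Lure.normT T y' ≤ r⁻¹ * Lure.normT T u) ∧
      Lure.gainLambda hT G φ A ≤ r⁻¹) ∧
    (∀ r : ℝ≥0∞, Lure.margin hT G (a A) (b A) = r → 0 < r →
      (∀ u y y' : ℝ → ℝ, Lure.IsResponse hT G φ u y y' → Lure.normSup y ≤ ENNReal.ofReal A →
        ∀ du : ℝ → ℝ, Lure.IsH1WithDeriv T u du →
          ∃ dy : ℝ → ℝ, Lure.IsH1WithDeriv T y' dy ∧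
            Lure.normT T dy ≤ r⁻¹ * Lure.normT T du) ∧
      Lure.gainLambdaDeriv hT G φ A ≤ r⁻¹) := by
  have hG := hcond.properStable
  -- The amplitude bound on `y` passes to its steady state, so the claims for `y` and for the gains
  -- both reduce to a bound on `y'`.
  have hbound : ∀ {u y y' : ℝ → ℝ}, Lure.IsResponse hT G φ u y y' →
      Lure.normSup y ≤ ENNReal.ofReal A → ∀ᵐ t ∂Lure.timeAxis, |y' t| ≤ A := by
    rintro u y y' ⟨-, e, e', -, -, hy⟩ hn
    exact Lure.ae_abs_steadyState_le hT hy (Lure.ae_abs_le_of_normSup_le hA hn)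
  refine ⟨fun r hr hr0 => ?_, fun r hr hr0 => ?_⟩
  · exact ⟨fun u y y' h hn =>
        Lure.normT_steadyState_le hφ hG hT hA hr0 hr.ge h (hbound h hn),
      sInf_le fun u y y' h hn => Lure.normT_steadyState_le hφ hG hT hA hr0 hr.ge h
        (Lure.ae_abs_le_of_normSup_le hA hn)⟩
  · have key : ∀ u y y' : ℝ → ℝ, Lure.IsResponse hT G φ u y y' →
        (∀ᵐ t ∂Lure.timeAxis, |y' t| ≤ A) → ∀ du : ℝ → ℝ, Lure.IsH1WithDeriv T u du →
          ∃ dy : ℝ → ℝ, Lure.IsH1WithDeriv T y' dy ∧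
            Lure.normT T dy ≤ r⁻¹ * Lure.normT T du := by
      intro u y y' h hb du hdu
      have hy' : Lure.IsL2e y' := by
        obtain ⟨-, e, e', -, -, hy⟩ := h
        exact hy.1
      -- The constant is `r⁻¹ ‖u'‖`, finite because `r > 0`.
      refine Lure.exists_isH1WithDeriv_of_shift_le hT hy'
        (ENNReal.mul_ne_top (ENNReal.inv_ne_top.2 hr0.ne') hdu.2.1.eLpNorm_ne_top) fun s hs => ?_
      refine (Lure.normT_shift_steadyState_sub_le hφ hG hT hA hr0 hr.ge h hb hs).trans ?_
      rw [mul_assoc, mul_comm (Lure.normT T du)]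
      gcongr
      exact Lure.normT_shift_sub_le hT h.1.isL2e h.1.isHalfWavePeriodic hdu hs
    exact ⟨fun u y y' h hn => key u y y' h (hbound h hn),
      sInf_le fun u y y' h hn => key u y y' h (Lure.ae_abs_le_of_normSup_le hA hn)⟩
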